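/- Let $(G_i)_{i\ge 0}$ be i.i.d. standard complex Gaussian random variables (density $\pi^{-1}e^{-|z|^2}$ on $\mathbb{C}$), and for $n\ge 0$ let $Z_1,\dots,Z_{N}$ be the roots, listed with multiplicity, of the Kac polynomial $P_n(z)=\sum_{i=0}^n G_i z^i$ (almost surely $N=n$). For $k\ge 0$, the $k$-point correlation function of these roots is the function $\rho_k^{(n)}:\mathbb{C}^k\to[0,\infty)$, $$\rho_k^{(n)}(z_1,\dots,z_k)=\mathbb{E}\Big[\sum_{i_1,\dots,i_k\ \text{pairwise distinct}}\ \prod_{\ell=1}^k\delta_0(Z_{i_\ell}-z_\ell)\Big],$$ i.e. the continuous function such that $\mathbb{E}\sum_{i_1,\dots,i_k\text{ pairwise distinct}}\varphi(Z_{i_1},\dots,Z_{i_k})=\int_{\mathbb{C}^k}\varphi\,\rho_k^{(n)}$ (integral with respect to Lebesgue measure) for every measurable $\varphi\ge 0$; such a function exists and is unique for all $n,k$. Then for every $k\ge 0$ and every real $y<1$, writing $\mathbb{D}(y)=\{z\in\mathbb{C}:|z|\le y\}$, $$\rho_k^{(n)}\longrightarrow\rho_k^{(\infty)}\qquad (n\to\infty)\quad\text{uniformly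 on }\mathbb{D}(y)^k,$$ where, at pairwise distinct points $z_1,\dots,z_k$ of the open unit disc, $$\rho_k^{(\infty)}(z_1,\dots,z_k)=\frac{\operatorname{per}\big(C-BA^{-1}B^*\big)}{\det(\pi A)},$$ and $\rho_k^{(\infty)}(z_1,\dots,z_k)=0$ if two of the points coincide. Here $A,B,C$ are the $k\times k$ matrices $$A_{ij}=h_\infty(z_i\overline{z_j}),\qquad B_{ij}=\overline{z_j}\,g_\infty(z_i\overline{z_j}),\qquad C_{ij}=g_\infty(z_i\overline{z_j})+z_i\overline{z_j}\,f_\infty(z_i\overline{z_j}),$$ with $h_\infty(z)=\frac1{1-z}$, $g_\infty(z)=h_\infty'(z)=\frac1{(1-z)^2}$, $f_\infty(z)=h_\infty''(z)=\frac2{(1-z)^3}$. -/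

import Mathlib

open MeasureTheory ProbabilityTheory Filter Topology
open scoped ENNReal ComplexConjugate

noncomputable section

/-- The standard complex Gaussian law on `ℂ` (mean `0`, `E|G|² = 1`), with density
`exp (-|z|²) / π` with respect to Lebesgue measure. -/
def stdComplexGaussian : Measure ℂ :=
  (volume : Measure ℂ).withDensity
    (fun z => ENNReal.ofReal (Real.exp (-‖z‖ ^ 2) / Real.pi))

/-- The polynomial `∑_{i=0}^n a_i X^i`. -/
def kacPolynomial (n : ℕ) (a : ℕ → ℂ) : Polynomial ℂ :=
  ∑ i ∈ Finset.range (n + 1), Polynomial.C (a i) * Polynomial.X ^ i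

/-- `∑ φ (Z_{i_1}, …, Z_{i_k})`, the sum being over all `k`-tuples of pairwise distinct indices
of the finite family `Z` of the elements of the multiset `s`, listed with multiplicity. -/
def sumDistinct (k : ℕ) (s : Multiset ℂ) (φ : (Fin k → ℂ) → ℝ≥0∞) : ℝ≥0∞ :=
  ∑ e : Fin k ↪ s.ToType, φ (fun j => (e j).1)

/-- `ρ` is the (continuous version of the) `k`-point correlation function, with respect to
Lebesgue measure, of the random finite multiset `Z` of complex numbers:
`E ∑_{i_1, …, i_k pairwise distinct} φ (Z_{i_1}, …, Z_{i_k}) = ∫ φ ρ` for every measurable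
`φ ≥ 0`. This says that `ρ(z) = E ∑ ∏_l δ_0 (Z_{i_l} - z_l)`. -/
structure IsCorrelationFunction {Ω : Type*} [MeasurableSpace Ω] (P : Measure Ω)
    (Z : Ω → Multiset ℂ) (k : ℕ) (ρ : (Fin k → ℂ) → ℝ) : Prop where
  continuous : Continuous ρ
  nonneg : ∀ z, 0 ≤ ρ z
  lintegral_eq : ∀ φ : (Fin k → ℂ) → ℝ≥0∞, Measurable φ →
    ∫⁻ ω, sumDistinct k (Z ω) φ ∂P = ∫⁻ z, φ z * ENNReal.ofReal (ρ z)

/-- `h_∞(z) = 1 / (1 - z)`. -/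
def hInf (z : ℂ) : ℂ := 1 / (1 - z)

/-- `g_∞(z) = 1 / (1 - z)²`, the derivative of `h_∞`. -/
def gInf (z : ℂ) : ℂ := 1 / (1 - z) ^ 2

/-- `f_∞(z) = 2 / (1 - z)³`, the second derivative of `h_∞`. -/
def fInf (z : ℂ) : ℂ := 2 / (1 - z) ^ 3

/-- `lim E[P(z_i) conj P(z_j)]`. -/
def covA {k : ℕ} (z : Fin k → ℂ) : Matrix (Fin k) (Fin k) ℂ :=
  Matrix.of fun i j => hInf (z i * conj (z j))

/-- `lim E[P'(z_i) conj P(z_j)]`. -/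
def covB {k : ℕ} (z : Fin k → ℂ) : Matrix (Fin k) (Fin k) ℂ :=
  Matrix.of fun i j => conj (z j) * gInf (z i * conj (z j))

/-- `lim E[P'(z_i) conj P'(z_j)]`, that is, `(x h_∞'(x))'` at `x = z_i conj z_j`. -/
def covC {k : ℕ} (z : Fin k → ℂ) : Matrix (Fin k) (Fin k) ℂ :=
  Matrix.of fun i j =>
    gInf (z i * conj (z j)) + z i * conj (z j) * fInf (z i * conj (z j))

open Classical in
/-- The limiting correlation function `per (C - B A⁻¹ B*) / det (π A)` at pairwise distinct
points, and `0` if two of the points coincide (there the quotient reads `0 / 0`). -/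
def rhoInf (k : ℕ) (z : Fin k → ℂ) : ℂ :=
  if Function.Injective z then
    (covC z - covB z * (covA z)⁻¹ * (covB z).conjTranspose).permanent /
      ((Real.pi : ℂ) • covA z).det
  else 0

end

/-! Choosing `k` distinct roots of a polynomial `P` amounts to factoring `P = p_z Q` with `p_z = ∏
(X - z_i)`. The map `(z, Q) ↦ p_z Q` has real Jacobian `|det V(z)|² ∏ |Q(z_i)|²`, where `V` is the
Vandermonde matrix; this is obtained by splitting off one linear factor at a time. Almost every
polynomial has simple roots (Sard), so the area formula with multiplicities expresses the `k`-point
function as the integral over `Q` of this Jacobian times the Gaussian density of the coefficients of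
`p_z Q` (`lintegral_sumDistinct`).

The permanent formula reads `0 / 0` on the diagonal, so convergence is proved on another expression.
The coefficients `t` of `p_z Q` of index at least `k` are unimodular coordinates for `Q`: then `Q`
is the quotient of `X ^ k * coeffPoly t` by `p_z`, and the lower coefficients of `p_z Q` are minus
the remainder. Hence the density is `|det V|² / π ^ k` times the expectation of `∏ |∑ G_{k+m}
q_{i,m}|² exp (-∑ |∑ G_{k+m} r_{j,m}|²)`, where `q` and `r` come from dividing `X ^ (k + m)` by
`p_z`. If `|z_i| ≤ y < θ < 1`, these are `O(θ ^ m)` uniformly in `z`, coinciding points included.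
Dominated convergence gives a joint limit as `N → ∞` and `z → z₀` (`tendsto_corrDensity`), and on a
compact set this is uniform convergence.

At distinct points the density for finite `N` is computed exactly
(`corrDensity_eq_permanent_div_det`). Let `E` and `D` evaluate `P` and `P'` at the points, and let
`A = E E*`. The Gaussian measure splits along `ker E` and its orthogonal complement. The operator `L
= D - D E* A⁻¹ E` kills the complement and agrees with `D` on `ker E`, where `P'(z_i) = p_z'(z_i)
Q(z_i)`. Wick's formula evaluates `E ∏ |(L a)_i|²` as `per (L L*)`, and the complement contributes
`det (π A)`. The matrices converge entrywise with `det A` nonzero in the limit, which identifies the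
limit as `rhoInf`; at coinciding points the Vandermonde factor makes it vanish. -/

/-! ### Area formula with multiplicities -/

section AreaFormula

variable {E : Type*} [NormedAddCommGroup E] [NormedSpace ℝ E] [FiniteDimensional ℝ E]
  [MeasurableSpace E] [BorelSpace E] (μ : Measure E) [μ.IsAddHaarMeasure]
  {f : E → E} {f' : E → E →L[ℝ] E}

/-- Sard: almost every value is regular. -/
theorem ae_forall_det_ne_zero (hf : ∀ x, HasFDerivAt f (f' x) x) :
    ∀ᵐ a ∂μ, ∀ x, f x = a → (f' x).det ≠ 0 := by
  have h := addHaar_image_eq_zero_of_det_fderivWithin_eq_zero μ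
    (s := {x | (f' x).det = 0}) (fun x _ => (hf x).hasFDerivWithinAt) (fun x hx => hx)
  rw [ae_iff]
  convert h using 2
  ext a
  simp only [Set.mem_ofPred_eq, Set.mem_image]
  push Not
  exact ⟨fun ⟨x, h1, h2⟩ => ⟨x, h2, h1⟩, fun ⟨x, h1, h2⟩ => ⟨x, h2, h1⟩⟩

/-- A differentiable map is injective on each piece of a countable measurable partition of its
regular points. -/
theorem exists_partition_injOn (hf : ∀ x, HasFDerivAt f (f' x) x)
    (hf' : Measurable fun x => (f' x).det) :
    ∃ t : ℕ → Set E, Pairwise (Function.onFun Disjoint t) ∧ (∀ n, MeasurableSet (t n)) ∧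
      (⋃ n, t n) = {x | (f' x).det ≠ 0} ∧ ∀ n, Set.InjOn f (t n) := by
  classical
  set s : Set E := {x | (f' x).det ≠ 0} with hs
  have hsm : MeasurableSet s := hf' (measurableSet_singleton 0).compl
  let r : (E →L[ℝ] E) → NNReal := fun A =>
    if h : A.det = 0 then 1 else
      if ‖((A.toContinuousLinearEquivOfDetNeZero h).symm : E →L[ℝ] E)‖₊ = 0 then 1 else
      ‖((A.toContinuousLinearEquivOfDetNeZero h).symm : E →L[ℝ] E)‖₊⁻¹ / 2
  have rpos : ∀ A, r A ≠ 0 := by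
    intro A
    simp only [r]
    split_ifs with h1 h2
    · exact one_ne_zero
    · exact one_ne_zero
    · exact div_ne_zero (inv_ne_zero h2) two_ne_zero
  obtain ⟨t, A, hd, hm, hc, ha, hy⟩ := exists_partition_approximatesLinearOn_of_hasFDerivWithinAt
    f s f' (fun x _ => (hf x).hasFDerivWithinAt) r rpos
  refine ⟨fun n => s ∩ t n, fun i j hij => (hd hij).mono Set.inter_subset_right
    Set.inter_subset_right, fun n => hsm.inter (hm n), ?_, fun n => ?_⟩
  · rw [← Set.inter_iUnion, Set.inter_eq_left.2 hc]
  · rcases Set.eq_empty_or_nonempty s with h0 | h0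
    · simp [h0]
    obtain ⟨y, hys, hAy⟩ := hy h0 n
    have hdet : (A n).det ≠ 0 := by rw [hAy]; exact hys
    have := ha n
    let B := (A n).toContinuousLinearEquivOfDetNeZero hdet
    have hB : (B : E →L[ℝ] E) = A n := by ext; rfl
    rw [← hB] at this
    refine this.injOn ?_
    rw [hB]
    simp only [r, hdet, dite_false]
    split_ifs with h1
    · left
      have : (B.symm : E →L[ℝ] E) = 0 := by simpa using h1
      constructor
      intro a b
      have h2 : ∀ x, B.symm x = 0 := fun x => by
        have := congrArg (fun L : E →L[ℝ] E => L x) this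
        simpa using this
      exact B.symm.injective ((h2 a).trans (h2 b).symm)
    · right
      exact NNReal.half_lt_self (inv_ne_zero h1)

theorem tsum_indicator_iUnion_inter {α : Type*} {t : ℕ → Set α}
    (hd : Pairwise (Function.onFun Disjoint t)) (A : Set α) (g : α → ℝ≥0∞) :
    ∑' x, ((⋃ n, t n) ∩ A).indicator g x = ∑' n, ∑' x, (t n ∩ A).indicator g x := by
  rw [ENNReal.tsum_comm]
  refine tsum_congr fun x => ?_
  by_cases hx : x ∈ (⋃ n, t n) ∩ A
  · obtain ⟨n, hn⟩ := Set.mem_iUnion.1 hx.1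
    rw [Set.indicator_of_mem hx, tsum_eq_single n,
      Set.indicator_of_mem (show x ∈ t n ∩ A from ⟨hn, hx.2⟩)]
    intro m hmn
    exact Set.indicator_of_notMem
      (fun h => Set.disjoint_left.1 (hd hmn) h.1 hn) _
  · rw [Set.indicator_of_notMem hx, eq_comm, ENNReal.tsum_eq_zero]
    exact fun n => Set.indicator_of_notMem
      (fun h => hx ⟨Set.mem_iUnion.2 ⟨n, h.1⟩, h.2⟩) _

theorem tsum_indicator_inter_preimage_apply {α β : Type*} {f : α → β} {t : Set α}
    (hi : Set.InjOn f t) {x : α} (hx : x ∈ t) (g : α → ℝ≥0∞) :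
    ∑' y, (t ∩ f ⁻¹' {f x}).indicator g y = g x := by
  rw [tsum_eq_single x, Set.indicator_of_mem (by exact ⟨hx, rfl⟩)]
  exact fun y hy => Set.indicator_of_notMem (fun h => hy (hi h.1 hx h.2)) _

theorem tsum_indicator_inter_preimage_of_notMem {α β : Type*} {f : α → β} {t : Set α}
    {a : β} (ha : a ∉ f '' t) (g : α → ℝ≥0∞) :
    ∑' y, (t ∩ f ⁻¹' {a}).indicator g y = 0 :=
  ENNReal.tsum_eq_zero.2 fun y =>
    Set.indicator_of_notMem (fun h => ha ⟨y, h.1, h.2⟩) _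

/-- Sums over the regular preimages of a point depend measurably on the point and on parameters. -/
theorem measurable_tsum_preimage {Y : Type*} [MeasurableSpace Y]
    (hf : ∀ x, HasFDerivAt f (f' x) x)
    (hf' : Measurable fun x => (f' x).det) {g : Y → E → ℝ≥0∞}
    (hg : Measurable (Function.uncurry g)) :
    Measurable fun q : Y × E =>
      ∑' x, ({x | (f' x).det ≠ 0} ∩ f ⁻¹' {q.2}).indicator (g q.1) x := by
  obtain ⟨t, hd, hm, hc, hi⟩ := exists_partition_injOn hf hf'
  have hcont : Continuous f := continuous_iff_continuousAt.2 fun x => (hf x).continuousAt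
  rw [← hc]
  simp_rw [tsum_indicator_iUnion_inter hd]
  refine Measurable.tsum fun n => ?_
  -- On a piece where `f` is injective the sum has at most one term, so it is an extension by zero
  -- along a measurable embedding.
  have hemb : MeasurableEmbedding (Prod.map (id : Y → Y) ((t n).domRestrict f)) :=
    MeasurableEmbedding.id.prodMap (hcont.continuousOn.measurableEmbedding (hm n) (hi n))
  have hG := hemb.measurable_extend (g := fun x => g x.1 x.2)
      (hg.comp (measurable_fst.prodMk (measurable_subtype_coe.comp measurable_snd)))
      (measurable_zero (α := ℝ≥0∞) (β := Y × E))
  convert hG with q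
  obtain ⟨p, a⟩ := q
  by_cases ha : a ∈ f '' t n
  · obtain ⟨x, hx, rfl⟩ := ha
    rw [tsum_indicator_inter_preimage_apply (hi n) hx]
    exact (hemb.injective.extend_apply (fun x => g x.1 x.2) 0 (p, ⟨x, hx⟩)).symm
  · rw [tsum_indicator_inter_preimage_of_notMem ha, eq_comm]
    refine Function.extend_apply' _ _ _ ?_
    rintro ⟨⟨p', x⟩, h⟩
    exact ha ⟨x, x.2, (Prod.ext_iff.1 h).2⟩

/-- The area formula, with multiplicities. -/
theorem lintegral_tsum_preimage (hf : ∀ x, HasFDerivAt f (f' x) x)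
    (hf' : Measurable fun x => (f' x).det) {g : E → ℝ≥0∞} (hg : Measurable g) :
    ∫⁻ a, ∑' x, ({x | (f' x).det ≠ 0} ∩ f ⁻¹' {a}).indicator g x ∂μ =
      ∫⁻ x, ENNReal.ofReal |(f' x).det| * g x ∂μ := by
  obtain ⟨t, hd, hm, hc, hi⟩ := exists_partition_injOn hf hf'
  have hcont : Continuous f := continuous_iff_continuousAt.2 fun x => (hf x).continuousAt
  have hG : ∀ n, AEMeasurable (fun a => ∑' x, (t n ∩ f ⁻¹' {a}).indicator g x) μ := by
    intro n
    have hemb := hcont.continuousOn.measurableEmbedding (hm n) (hi n)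
    have hG := hemb.measurable_extend (g := fun x => g x) (hg.comp measurable_subtype_coe)
      (measurable_zero (α := ℝ≥0∞) (β := E))
    refine Measurable.aemeasurable ?_
    convert hG with a
    by_cases ha : a ∈ f '' t n
    · obtain ⟨x, hx, rfl⟩ := ha
      rw [tsum_indicator_inter_preimage_apply (hi n) hx]
      exact (hemb.injective.extend_apply (fun x => g x) 0 ⟨x, hx⟩).symm
    · rw [tsum_indicator_inter_preimage_of_notMem ha, eq_comm]
      refine Function.extend_apply' _ _ _ ?_
      rintro ⟨x, rfl⟩
      exact ha ⟨x, x.2, rfl⟩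
  have h1 : ∀ n, ∫⁻ a, ∑' x, (t n ∩ f ⁻¹' {a}).indicator g x ∂μ =
      ∫⁻ x in t n, ENNReal.ofReal |(f' x).det| * g x ∂μ := by
    intro n
    have hmi : MeasurableSet (f '' t n) :=
      (hm n).image_of_continuousOn_injOn hcont.continuousOn (hi n)
    rw [← setLIntegral_eq_of_support_subset (s := f '' t n)]
    · rw [lintegral_image_eq_lintegral_abs_det_fderiv_mul μ (hm n)
        (fun x _ => (hf x).hasFDerivWithinAt) (hi n)]
      refine setLIntegral_congr_fun (hm n) fun x hx => ?_
      simp only [tsum_indicator_inter_preimage_apply (hi n) hx]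
    · intro a ha
      by_contra h
      exact ha (tsum_indicator_inter_preimage_of_notMem h g)
  have h2 : ∀ a, ∑' x, ({x | (f' x).det ≠ 0} ∩ f ⁻¹' {a}).indicator g x =
      ∑' n, ∑' x, (t n ∩ f ⁻¹' {a}).indicator g x := fun a => by
    rw [← hc, tsum_indicator_iUnion_inter hd]
  simp_rw [h2]
  rw [lintegral_tsum hG]
  simp_rw [h1]
  -- Critical points contribute nothing to the right side because the determinant is a factor of the
  -- integrand.
  rw [← lintegral_iUnion hm hd, hc, setLIntegral_eq_of_support_subset]
  intro x hx
  contrapose! hx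
  simp only [Set.mem_ofPred_eq, not_not] at hx
  simp [hx]

end AreaFormula

/-! ### Real determinants of complex matrices -/

section ComplexDet

variable {ι : Type*} [Fintype ι] [DecidableEq ι]

/-- The real continuous linear map of a complex matrix. -/
noncomputable def Matrix.toRealCLM (M : Matrix ι ι ℂ) : (ι → ℂ) →L[ℝ] (ι → ℂ) :=
  LinearMap.toContinuousLinearMap ((Matrix.toLin' M).restrictScalars ℝ)

@[simp] theorem Matrix.toRealCLM_apply (M : Matrix ι ι ℂ) (x : ι → ℂ) :
    M.toRealCLM x = M.mulVec x := rfl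

theorem Matrix.det_toRealCLM (M : Matrix ι ι ℂ) : M.toRealCLM.det = ‖M.det‖ ^ 2 := by
  simp [Matrix.toRealCLM, ContinuousLinearMap.det, LinearMap.det_restrictScalars,
    Algebra.norm_complex_eq, Complex.normSq_eq_norm_sq]

theorem lintegral_mulVec (M : Matrix ι ι ℂ) (hM : M.det ≠ 0) (f : (ι → ℂ) → ℝ≥0∞) :
    ∫⁻ x, f x = ENNReal.ofReal (‖M.det‖ ^ 2) * ∫⁻ x, f (M.mulVec x) := by
  have h := lintegral_image_eq_lintegral_abs_det_fderiv_mul (volume : Measure (ι → ℂ))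
    MeasurableSet.univ (f := fun x => M.mulVec x) (f' := fun _ => M.toRealCLM)
    (fun x _ => M.toRealCLM.hasFDerivAt.hasFDerivWithinAt)
    ((Matrix.mulVec_injective_of_isUnit ((Matrix.isUnit_iff_isUnit_det M).2 hM.isUnit)).injOn) f
  have hs : Function.Surjective (fun x => M.mulVec x) :=
    Matrix.mulVec_surjective_iff_isUnit.2 ((Matrix.isUnit_iff_isUnit_det M).2 hM.isUnit)
  rw [Set.image_univ, hs.range_eq] at h
  simp only [Measure.restrict_univ, Matrix.det_toRealCLM] at h
  rw [h, lintegral_const_mul', abs_of_nonneg (by positivity)]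
  exact ENNReal.ofReal_ne_top

end ComplexDet

/-! ### Polynomials as coefficient vectors -/

section CoeffPoly

open Polynomial

variable {N k : ℕ}

/-- The polynomial with a given vector of coefficients. -/
noncomputable def coeffPoly (a : Fin N → ℂ) : ℂ[X] := ∑ i, C (a i) * X ^ (i : ℕ)

theorem coeffPoly_coeff (a : Fin N → ℂ) (i : Fin N) : (coeffPoly a).coeff i = a i := by
  simp only [coeffPoly, finsetSum_coeff, coeff_C_mul, coeff_X_pow, Fin.val_inj, mul_ite, mul_one,
    mul_zero]
  simp

theorem coeffPoly_degree_lt (a : Fin N → ℂ) : (coeffPoly a).degree < N := by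
  rw [degree_lt_iff_coeff_zero]
  intro m hm
  simp only [coeffPoly, finsetSum_coeff, coeff_C_mul, coeff_X_pow]
  exact Finset.sum_eq_zero fun i _ => by rw [if_neg (by omega), mul_zero]

theorem coeffPoly_coeff_of_le (a : Fin N → ℂ) {i : ℕ} (hi : N ≤ i) : (coeffPoly a).coeff i = 0 :=
  coeff_eq_zero_of_degree_lt ((coeffPoly_degree_lt a).trans_le (by exact_mod_cast hi))

theorem coeffPoly_injective : Function.Injective (coeffPoly : (Fin N → ℂ) → ℂ[X]) := by
  intro a b h
  funext i
  rw [← coeffPoly_coeff a, ← coeffPoly_coeff b, h]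

theorem coeffPoly_coeff_eq {p : ℂ[X]} (hp : p.degree < N) :
    coeffPoly (fun i : Fin N => p.coeff i) = p := by
  ext j
  rcases lt_or_ge j N with hj | hj
  · exact coeffPoly_coeff (fun i : Fin N => p.coeff i) ⟨j, hj⟩
  · rw [coeffPoly_coeff_of_le _ hj, eq_comm]
    exact coeff_eq_zero_of_degree_lt (hp.trans_le (by exact_mod_cast hj))

theorem coeffPoly_eval (a : Fin N → ℂ) (w : ℂ) :
    (coeffPoly a).eval w = ∑ i : Fin N, a i * w ^ (i : ℕ) := by
  simp [coeffPoly, eval_finsetSum]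

/-- The monic polynomial with given roots. -/
noncomputable def rootPoly (z : Fin k → ℂ) : ℂ[X] := ∏ i, (X - C (z i))

theorem rootPoly_monic (z : Fin k → ℂ) : (rootPoly z).Monic :=
  monic_prod_of_monic _ _ fun i _ => monic_X_sub_C (z i)

theorem rootPoly_degree (z : Fin k → ℂ) : (rootPoly z).degree = k := by
  simp [rootPoly, degree_prod]

theorem rootPoly_natDegree (z : Fin k → ℂ) : (rootPoly z).natDegree = k :=
  natDegree_eq_of_degree_eq_some (rootPoly_degree z)

theorem rootPoly_cons (w : ℂ) (z : Fin k → ℂ) :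
    rootPoly (Fin.cons w z : Fin (k + 1) → ℂ) = (X - C w) * rootPoly z := by
  simp [rootPoly, Fin.prod_univ_succ]

theorem rootPoly_mul_degree_lt (z : Fin k → ℂ) (b : Fin N → ℂ) :
    (rootPoly z * coeffPoly b).degree < (N + k : ℕ) := by
  rw [degree_mul, rootPoly_degree, add_comm]
  have := coeffPoly_degree_lt b
  push_cast
  exact WithBot.add_lt_add_right (WithBot.coe_ne_bot) this

theorem rootPoly_mul_inj {z : Fin k → ℂ} {b c : Fin N → ℂ}
    (h : rootPoly z * coeffPoly b = rootPoly z * coeffPoly c) : b = c :=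
  coeffPoly_injective (mul_left_cancel₀ (rootPoly_monic z).ne_zero h)

end CoeffPoly

/-! ### Splitting off one linear factor -/

section LinearFactor

open Polynomial

variable {N : ℕ}

/-- The coefficient vector of `(X - x 0) * Q`, where `Q` has coefficients `x 1, …, x N`. -/
noncomputable def linearFactorMul (x : Fin (N + 1) → ℂ) : Fin (N + 1) → ℂ :=
  (Fin.cons 0 (Fin.tail x) : Fin (N + 1) → ℂ) - x 0 • (Fin.snoc (Fin.tail x) 0 : Fin (N + 1) → ℂ)

theorem coeffPoly_cons (w : ℂ) (b : Fin N → ℂ) :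
    coeffPoly (Fin.cons w b : Fin (N + 1) → ℂ) = C w + X * coeffPoly b := by
  simp only [coeffPoly, Fin.sum_univ_succ, Fin.cons_zero, Fin.cons_succ, Finset.mul_sum]
  simp [pow_succ', mul_left_comm]

theorem coeffPoly_snoc (w : ℂ) (b : Fin N → ℂ) :
    coeffPoly (Fin.snoc b w : Fin (N + 1) → ℂ) = coeffPoly b + C w * X ^ N := by
  simp [coeffPoly, Fin.sum_univ_castSucc]

theorem coeffPoly_linearFactorMul (x : Fin (N + 1) → ℂ) :
    coeffPoly (linearFactorMul x) = (X - C (x 0)) * coeffPoly (Fin.tail x) := by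
  have h : coeffPoly (linearFactorMul x) = coeffPoly (Fin.cons 0 (Fin.tail x) : Fin (N + 1) → ℂ) -
      C (x 0) * coeffPoly (Fin.snoc (Fin.tail x) 0 : Fin (N + 1) → ℂ) := by
    simp only [coeffPoly, linearFactorMul, Pi.sub_apply, Pi.smul_apply, smul_eq_mul, C_sub, C_mul,
      sub_mul, Finset.sum_sub_distrib, Finset.mul_sum, mul_assoc]
  rw [h, coeffPoly_cons, coeffPoly_snoc]
  simp
  ring

/-- The Jacobian matrix of `linearFactorMul`. -/
noncomputable def linearFactorJac (x : Fin (N + 1) → ℂ) : Matrix (Fin (N + 1)) (Fin (N + 1)) ℂ :=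
  Matrix.of fun i j => Fin.cases (-(Fin.snoc (Fin.tail x) 0 : Fin (N + 1) → ℂ) i)
    (fun j' => (if i = j'.succ then 1 else 0) - x 0 * (if i = j'.castSucc then 1 else 0)) j

theorem hasFDerivAt_linearFactorMul (x : Fin (N + 1) → ℂ) :
    HasFDerivAt (linearFactorMul (N := N)) (linearFactorJac x).toRealCLM x := by
  have h0 : ∀ i, HasFDerivAt (𝕜 := ℝ) (fun x : Fin (N + 1) → ℂ => x i)
    (ContinuousLinearMap.proj i) x := fun i => hasFDerivAt_apply i x
  rw [hasFDerivAt_pi']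
  intro i
  have h1 : HasFDerivAt (𝕜 := ℝ)
      (fun x : Fin (N + 1) → ℂ => (Fin.cons 0 (Fin.tail x) : Fin (N + 1) → ℂ) i)
      (Fin.cases 0 (fun i' => ContinuousLinearMap.proj i'.succ) i :
        (Fin (N + 1) → ℂ) →L[ℝ] ℂ) x := by
    refine Fin.cases ?_ (fun i' => ?_) i
    · simpa using hasFDerivAt_const (0 : ℂ) x
    · simpa [Fin.tail] using h0 i'.succ
  have h2 : HasFDerivAt (𝕜 := ℝ)
      (fun x : Fin (N + 1) → ℂ => (Fin.snoc (Fin.tail x) 0 : Fin (N + 1) → ℂ) i)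
      (Fin.lastCases 0 (fun i' => ContinuousLinearMap.proj i'.succ) i :
        (Fin (N + 1) → ℂ) →L[ℝ] ℂ) x := by
    refine Fin.lastCases ?_ (fun i' => ?_) i
    · simpa using hasFDerivAt_const (0 : ℂ) x
    · simpa [Fin.tail] using h0 i'.succ
  refine (h1.sub ((h0 0).mul h2)).congr_fderiv ?_
  ext v
  have e1 : (Fin.cases 0 (fun i' => ContinuousLinearMap.proj i'.succ) i :
        (Fin (N + 1) → ℂ) →L[ℝ] ℂ) v = ∑ j : Fin N, (if i = j.succ then 1 else 0) * v j.succ := by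
    refine Fin.cases ?_ (fun i' => ?_) i
    · simp [eq_comm (a := (0 : Fin (N + 1)))]
    · simp
  have e2 : (Fin.lastCases 0 (fun i' => ContinuousLinearMap.proj i'.succ) i :
        (Fin (N + 1) → ℂ) →L[ℝ] ℂ) v =
        ∑ j : Fin N, (if i = j.castSucc then 1 else 0) * v j.succ := by
    refine Fin.lastCases ?_ (fun i' => ?_) i
    · rw [Fin.lastCases_last]
      simp [Fin.ext_iff, fun j : Fin N => (j.2).ne']
    · simp
  have e3 : (linearFactorJac x).mulVec v i =
      -(Fin.snoc (Fin.tail x) 0 : Fin (N + 1) → ℂ) i * v 0 +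
        ∑ j : Fin N, ((if i = j.succ then 1 else 0) - x 0 * (if i = j.castSucc then 1 else 0)) *
          v j.succ := by
    rw [Matrix.mulVec, dotProduct, Fin.sum_univ_succ]
    rfl
  simp only [ContinuousLinearMap.comp_apply, Matrix.toRealCLM_apply,
    ContinuousLinearMap.proj_apply, e3, sub_mul, Finset.sum_sub_distrib, mul_assoc,
    ← Finset.mul_sum]
  simp only [sub_apply, add_apply, smul_apply, e1, e2, ContinuousLinearMap.proj_apply, smul_eq_mul]
  simp
  ring

/-- Column `0` of the Jacobian is the polynomial `-Q`, and the others are `(X - x 0) X ^ j`. Adding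
`x 0 ^ i` times row `i` to row `0` evaluates every column at `x 0`, which leaves only `-Q (x 0)` in
that row; the complementary minor is upper unitriangular. -/
theorem det_linearFactorJac (x : Fin (N + 1) → ℂ) :
    (linearFactorJac x).det = -(coeffPoly (Fin.tail x)).eval (x 0) := by
  have h := Matrix.det_updateRow_sum (linearFactorJac x) 0 fun i => x 0 ^ (i : ℕ)
  rw [Fin.val_zero, pow_zero, one_smul] at h
  rw [← h, Matrix.det_succ_row_zero, Fin.sum_univ_succ,
    Finset.sum_eq_zero (s := Finset.univ (α := Fin N)), add_zero]
  · have ht : ((linearFactorJac x).submatrix Fin.succ Fin.succ).det = 1 := by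
      rw [Matrix.det_of_isUpperTriangular]
      · refine Finset.prod_eq_one fun i _ => ?_
        simp [linearFactorJac, Fin.ext_iff]
      · intro i j hij
        have h1 : (j : ℕ) < i := hij
        simp [linearFactorJac, Fin.ext_iff, h1.ne', (h1.trans (Nat.lt_succ_self _)).ne']
    have hs : ((linearFactorJac x).updateRow 0
        (∑ i : Fin (N + 1), x 0 ^ (i : ℕ) • linearFactorJac x i)).submatrix Fin.succ
          (Fin.succAbove 0) =
        (linearFactorJac x).submatrix Fin.succ Fin.succ := by
      ext i j
      simp [Matrix.updateRow_apply]
    rw [hs, ht]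
    simp [linearFactorJac, coeffPoly_eval, Fin.sum_univ_castSucc, mul_comm]
  · intro j _
    have : (∑ k : Fin (N + 1), x 0 ^ (k : ℕ) • linearFactorJac x k) j.succ = 0 := by
      simp [linearFactorJac, mul_sub, Finset.sum_sub_distrib, Finset.sum_apply]
      ring
    simp [this]

end LinearFactor

/-! ### Change of variables for `k` marked roots -/

section RootSum

open Polynomial

variable {N k M : ℕ}

theorem lintegral_fin_cons {f : (Fin (N + 1) → ℂ) → ℝ≥0∞} (hf : Measurable f) :
    ∫⁻ x, f x = ∫⁻ w : ℂ, ∫⁻ c : Fin N → ℂ, f (Fin.cons w c) := by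
  have h := (volume_preserving_piFinSuccAbove (fun _ : Fin (N + 1) => ℂ) 0).symm.lintegral_comp hf
  rw [← h, Measure.volume_eq_prod, lintegral_prod]
  · simp [MeasurableEquiv.piFinSuccAbove, Fin.insertNthEquiv]
  · exact (hf.comp (MeasurableEquiv.measurable _)).aemeasurable

theorem measurable_fin_cons :
    Measurable fun q : ℂ × (Fin N → ℂ) => (Fin.cons q.1 q.2 : Fin (N + 1) → ℂ) := by
  rw [measurable_pi_iff]
  refine Fin.cases ?_ fun i => ?_
  · simpa using measurable_fst
  · exact (measurable_pi_apply i).comp measurable_snd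

theorem measurable_fin_uncons :
    Measurable fun x : Fin (N + 1) → ℂ => (x 0, Fin.tail x) := by
  refine Measurable.prodMk (measurable_pi_apply 0) (measurable_pi_iff.2 fun i => ?_)
  exact measurable_pi_apply (X := fun _ : Fin (N + 1) => ℂ) i.succ

theorem tsum_fin_cons (f : (Fin (N + 1) → ℂ) → ℝ≥0∞) :
    ∑' x, f x = ∑' w : ℂ, ∑' c : Fin N → ℂ, f (Fin.cons w c) := by
  rw [← ENNReal.tsum_prod, ← (Fin.consEquiv fun _ : Fin (N + 1) => ℂ).tsum_eq]
  rfl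

theorem continuous_coeffPoly_eval :
    Continuous fun q : (Fin N → ℂ) × ℂ => (coeffPoly q.1).eval q.2 := by
  simp only [coeffPoly_eval]
  fun_prop

/-- The squared modulus of the Jacobian of `(z, b) ↦ rootPoly z * coeffPoly b`. -/
noncomputable def rootWeight (z : Fin k → ℂ) (b : Fin N → ℂ) : ℝ :=
  ‖(Matrix.vandermonde z).det‖ ^ 2 * ∏ i, ‖(coeffPoly b).eval (z i)‖ ^ 2

theorem rootWeight_nonneg (z : Fin k → ℂ) (b : Fin N → ℂ) : 0 ≤ rootWeight z b := by
  unfold rootWeight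
  positivity

theorem continuous_det_vandermonde :
    Continuous fun z : Fin k → ℂ => (Matrix.vandermonde z).det := by
  simp only [Matrix.det_vandermonde]
  fun_prop

theorem continuous_rootWeight :
    Continuous fun q : (Fin k → ℂ) × (Fin N → ℂ) => rootWeight q.1 q.2 := by
  unfold rootWeight
  refine ((continuous_det_vandermonde.comp continuous_fst).norm.pow 2).mul
    (continuous_finsetProd _ fun i _ => ?_)
  exact ((continuous_coeffPoly_eval (N := N)).comp
    (continuous_snd.prodMk ((continuous_apply i).comp continuous_fst))).norm.pow 2

theorem norm_rootPoly_eval (z : Fin k → ℂ) (w : ℂ) :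
    ‖(rootPoly z).eval w‖ = ∏ i, ‖z i - w‖ := by
  simp [rootPoly, eval_prod, norm_sub_rev]

/-- The extra factor is the squared modulus of the Jacobian of `linearFactorMul` at the root `w`
with cofactor `rootPoly z * coeffPoly b`; this drives the inductions on `k`. -/
theorem rootWeight_cons (w : ℂ) (z : Fin k → ℂ) (b : Fin N → ℂ) :
    rootWeight (Fin.cons w z : Fin (k + 1) → ℂ) b =
      rootWeight z b * ‖(rootPoly z * coeffPoly b).eval w‖ ^ 2 := by
  simp only [rootWeight, Matrix.det_vandermonde, Fin.prod_univ_succ, Fin.cons_zero, Fin.cons_succ,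
    eval_mul, norm_mul, norm_rootPoly_eval, Fin.Ioi_zero_eq_map, Finset.prod_map, norm_prod,
    Fin.coe_succEmb, Fin.Ioi_succ]
  ring

open Classical in
/-- Sum over all `z : Fin k → ℂ` and `b` with `coeffPoly a = rootPoly z * coeffPoly b`. -/
noncomputable def rootSum (k : ℕ) (g : (Fin k → ℂ) → (Fin N → ℂ) → ℝ≥0∞)
    (a : Fin M → ℂ) : ℝ≥0∞ :=
  ∑' z, ∑' b, if rootWeight z b ≠ 0 ∧ coeffPoly a = rootPoly z * coeffPoly b then g z b else 0

theorem rootSum_zero (g : (Fin 0 → ℂ) → (Fin N → ℂ) → ℝ≥0∞) (a : Fin N → ℂ) :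
    rootSum 0 g a = g Fin.elim0 a := by
  rw [rootSum, tsum_eq_single Fin.elim0 fun z hz => (hz (Subsingleton.elim _ _)).elim,
    tsum_eq_single a]
  · simp [rootWeight, rootPoly]
  · intro b hb
    refine if_neg fun h => hb ?_
    simpa [rootPoly, coeffPoly_injective.eq_iff, eq_comm] using h.2

/-- The root `x 0` is split off first and the other `k` are found in the cofactor. By
`rootWeight_cons` the total weight is nonzero exactly when both stages are regular, so the area
formula for one factor can be iterated. -/
theorem rootSum_succ (g : (Fin (k + 1) → ℂ) → (Fin N → ℂ) → ℝ≥0∞) (a : Fin (N + k + 1) → ℂ) :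
    rootSum (k + 1) g a = ∑' x : Fin (N + k + 1) → ℂ,
      ({x | (linearFactorJac x).toRealCLM.det ≠ 0} ∩ linearFactorMul ⁻¹' {a}).indicator
        (fun x => rootSum k (fun z => g (Fin.cons (x 0) z)) (Fin.tail x)) x := by
  classical
  rw [rootSum, tsum_fin_cons, tsum_fin_cons]
  refine tsum_congr fun w => ?_
  have h1 : ∀ c : Fin (N + k) → ℂ,
      ({x : Fin (N + k + 1) → ℂ | (linearFactorJac x).toRealCLM.det ≠ 0} ∩
        linearFactorMul ⁻¹' {a}).indicator
        (fun x => rootSum k (fun z => g (Fin.cons (x 0) z)) (Fin.tail x)) (Fin.cons w c) =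
      ∑' z : Fin k → ℂ, ∑' b : Fin N → ℂ,
        if ((coeffPoly c).eval w ≠ 0 ∧ coeffPoly a = (X - C w) * coeffPoly c) ∧
          rootWeight z b ≠ 0 ∧ coeffPoly c = rootPoly z * coeffPoly b
        then g (Fin.cons w z) b else 0 := by
    intro c
    have h2 : (Fin.cons w c : Fin (N + k + 1) → ℂ) ∈
        ({x : Fin (N + k + 1) → ℂ | (linearFactorJac x).toRealCLM.det ≠ 0} ∩
        linearFactorMul ⁻¹' {a}) ↔
        ((coeffPoly c).eval w ≠ 0 ∧ coeffPoly a = (X - C w) * coeffPoly c) := by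
      have h3 : linearFactorMul (Fin.cons w c : Fin (N + k + 1) → ℂ) = a ↔
          coeffPoly a = (X - C w) * coeffPoly c := by
        rw [← (coeffPoly_injective (N := N + k + 1)).eq_iff, coeffPoly_linearFactorMul]
        simp [eq_comm]
      simp [Matrix.det_toRealCLM, det_linearFactorJac, h3]
    by_cases h : ((coeffPoly c).eval w ≠ 0 ∧ coeffPoly a = (X - C w) * coeffPoly c)
    · rw [Set.indicator_of_mem (h2.2 h), rootSum]
      simp only [Fin.cons_zero, Fin.tail_cons]
      simp [h.1, h.2]
    · rw [Set.indicator_of_notMem (mt h2.1 h), eq_comm]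
      simp only [h, false_and, if_false, tsum_zero]
  simp_rw [h1]
  conv_rhs => rw [ENNReal.tsum_comm]
  refine tsum_congr fun z => ?_
  conv_rhs => rw [ENNReal.tsum_comm]
  refine tsum_congr fun b => ?_
  have hc := coeffPoly_coeff_eq (rootPoly_mul_degree_lt z b)
  -- The intermediate cofactor `c` is forced to be the coefficient vector of `rootPoly z * coeffPoly
  -- b`.
  rw [tsum_eq_single fun i : Fin (N + k) => (rootPoly z * coeffPoly b).coeff i]
  · rw [hc, rootWeight_cons, rootPoly_cons, mul_assoc]
    refine if_congr ?_ rfl rfl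
    simp only [ne_eq, mul_eq_zero, not_or, pow_eq_zero_iff two_ne_zero, norm_eq_zero]
    tauto
  · intro c hc'
    refine if_neg fun h => hc' (coeffPoly_injective ?_)
    rw [h.2.2, hc]

theorem continuous_det_linearFactorJac :
    Continuous fun x : Fin (N + 1) → ℂ => (linearFactorJac x).toRealCLM.det := by
  simp only [Matrix.det_toRealCLM, det_linearFactorJac]
  refine Continuous.pow (Continuous.norm (Continuous.neg ?_)) 2
  refine continuous_coeffPoly_eval.comp (Continuous.prodMk ?_ (continuous_apply 0))
  exact continuous_pi fun i => continuous_apply i.succ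

/-- The parameter space `Y` stores the roots already split off; the induction step enlarges it by
one factor `ℂ`. -/
theorem measurable_rootSum {Y : Type} [MeasurableSpace Y] (hM : M = N + k)
    {g : Y → (Fin k → ℂ) → (Fin N → ℂ) → ℝ≥0∞}
    (hg : Measurable fun q : Y × (Fin k → ℂ) × (Fin N → ℂ) => g q.1 q.2.1 q.2.2) :
    Measurable fun q : Y × (Fin M → ℂ) => rootSum k (g q.1) q.2 := by
  induction k generalizing Y M with
  | zero =>
    obtain rfl : M = N := hM
    simp only [rootSum_zero]
    exact hg.comp (measurable_fst.prodMk (measurable_const.prodMk measurable_snd))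
  | succ k ih =>
    obtain rfl : M = N + k + 1 := hM
    simp only [rootSum_succ]
    have hm : Measurable (Function.uncurry fun (y : Y) (x : Fin (N + k + 1) → ℂ) =>
        rootSum k (fun z => g y (Fin.cons (x 0) z)) (Fin.tail x)) := by
      have h2 : Measurable fun q : (Y × ℂ) × (Fin k → ℂ) × (Fin N → ℂ) =>
          (q.1.1, (Fin.cons q.1.2 q.2.1 : Fin (k + 1) → ℂ), q.2.2) :=
        (measurable_fst.comp measurable_fst).prodMk ((measurable_fin_cons.comp
          ((measurable_snd.comp measurable_fst).prodMk (measurable_fst.comp measurable_snd))).prodMk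
          (measurable_snd.comp measurable_snd))
      have h := ih (Y := Y × ℂ) rfl (g := fun q z => g q.1 (Fin.cons q.2 z)) (hg.comp h2)
      have hu := measurable_fin_uncons (N := N + k)
      have h3 : Measurable fun q : Y × (Fin (N + k + 1) → ℂ) =>
          ((q.1, q.2 0), Fin.tail q.2) :=
        (measurable_fst.prodMk (hu.fst.comp measurable_snd)).prodMk (hu.snd.comp measurable_snd)
      have h4 := h.comp h3
      simp only [Function.comp_def] at h4
      exact h4
    exact measurable_tsum_preimage hasFDerivAt_linearFactorMul
      continuous_det_linearFactorJac.measurable hm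

/-- Inside the sum `a` is the coefficient vector of the product, so a function of `a` becomes a
weight in `(z, b)`. This carries the Jacobian of each splitting, and later the Gaussian density,
into the sum. -/
theorem mul_rootSum (φ : (Fin M → ℂ) → ℝ≥0∞) (g : (Fin k → ℂ) → (Fin N → ℂ) → ℝ≥0∞)
    (a : Fin M → ℂ) :
    φ a * rootSum k g a =
      rootSum k (fun z b => φ (fun i => (rootPoly z * coeffPoly b).coeff i) * g z b) a := by
  simp only [rootSum, ← ENNReal.tsum_mul_left]
  refine tsum_congr fun z => tsum_congr fun b => ?_
  rw [mul_ite, mul_zero]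
  refine if_ctx_congr Iff.rfl (fun h => ?_) fun _ => rfl
  rw [← h.2]
  simp only [coeffPoly_coeff]

theorem continuous_coeff_rootPoly (m : ℕ) :
    Continuous fun z : Fin k → ℂ => (rootPoly z).coeff m := by
  induction k generalizing m with
  | zero => simpa [rootPoly] using continuous_const
  | succ k ih =>
    have h : ∀ z : Fin (k + 1) → ℂ, rootPoly z = (X - C (z 0)) * rootPoly (Fin.tail z) :=
        fun z => by
      conv_lhs => rw [← Fin.cons_self_tail z, rootPoly_cons]
    have ht : Continuous fun z : Fin (k + 1) → ℂ => Fin.tail z :=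
      continuous_pi fun i => continuous_apply i.succ
    simp only [h, sub_mul, coeff_sub, coeff_C_mul]
    refine Continuous.sub ?_ ((continuous_apply 0).mul ((ih m).comp ht))
    cases m with
    | zero => simpa using continuous_const
    | succ m =>
      simp only [coeff_X_mul]
      exact (ih m).comp ht

theorem continuous_coeff_rootPoly_mul (m : ℕ) :
    Continuous fun q : (Fin k → ℂ) × (Fin N → ℂ) =>
      (rootPoly q.1 * coeffPoly q.2).coeff m := by
  simp only [coeffPoly, Finset.mul_sum, finsetSum_coeff]
  refine continuous_finsetSum _ fun i _ => ?_
  simp only [mul_left_comm _ (C _), coeff_C_mul, coeff_mul_X_pow']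
  split_ifs
  · exact ((continuous_apply i).comp continuous_snd).mul
      ((continuous_coeff_rootPoly _).comp continuous_fst)
  · simpa using continuous_const

/-- The area formula is applied to one root at a time, and `rootWeight` accumulates the successive
Jacobians; the Jacobian matrix of the full map is never needed. -/
theorem lintegral_rootSum (hM : M = N + k) {g : (Fin k → ℂ) → (Fin N → ℂ) → ℝ≥0∞}
    (hg : Measurable (Function.uncurry g)) :
    ∫⁻ a : Fin M → ℂ, rootSum k g a = ∫⁻ z, ∫⁻ b, ENNReal.ofReal (rootWeight z b) * g z b := by
  induction k generalizing M with
  | zero =>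
    obtain rfl : M = N := hM
    simp only [rootSum_zero]
    rw [lintegral_unique (α := Fin 0 → ℂ)]
    simp only [rootWeight, volume_pi, Measure.pi_univ, Finset.univ_eq_empty, Finset.prod_empty,
      mul_one, Matrix.det_isEmpty, norm_one, one_pow, ENNReal.ofReal_one, one_mul]
    rfl
  | succ k ih =>
    obtain rfl : M = N + k + 1 := hM
    have hg' : Measurable fun q : ℂ × (Fin k → ℂ) × (Fin N → ℂ) =>
        g (Fin.cons q.1 q.2.1) q.2.2 :=
      hg.comp ((measurable_fin_cons.comp
        (measurable_fst.prodMk (measurable_fst.comp measurable_snd))).prodMk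
        (measurable_snd.comp measurable_snd))
    have hr := measurable_rootSum rfl (g := fun (w : ℂ) z => g (Fin.cons w z)) hg'
    have hm : Measurable fun x : Fin (N + k + 1) → ℂ =>
        rootSum k (fun z => g (Fin.cons (x 0) z)) (Fin.tail x) := by
      have h4 := hr.comp (measurable_fin_uncons (N := N + k))
      simp only [Function.comp_def] at h4
      exact h4
    simp only [rootSum_succ]
    refine (lintegral_tsum_preimage (volume : Measure (Fin (N + k + 1) → ℂ))
      hasFDerivAt_linearFactorMul
      continuous_det_linearFactorJac.measurable hm).trans ?_
    have hp : Measurable fun x : Fin (N + k + 1) → ℂ =>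
        ENNReal.ofReal |(linearFactorJac x).toRealCLM.det| *
          rootSum k (fun z => g (Fin.cons (x 0) z)) (Fin.tail x) :=
      continuous_det_linearFactorJac.abs.measurable.ennreal_ofReal.mul hm
    rw [lintegral_fin_cons hp, lintegral_fin_cons]
    · refine lintegral_congr fun w => ?_
      simp only [Matrix.det_toRealCLM, det_linearFactorJac, Fin.cons_zero, Fin.tail_cons, norm_neg,
        abs_pow, abs_norm]
      have h := fun c : Fin (N + k) → ℂ => mul_rootSum (fun c : Fin (N + k) → ℂ =>
        ENNReal.ofReal (‖(coeffPoly c).eval w‖ ^ 2)) (fun z => g (Fin.cons w z)) c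
      simp_rw [h, coeffPoly_coeff_eq (rootPoly_mul_degree_lt _ _)]
      rw [ih rfl]
      · refine lintegral_congr fun z => lintegral_congr fun b => ?_
        rw [rootWeight_cons, ENNReal.ofReal_mul (rootWeight_nonneg z b), mul_assoc]
      · refine Measurable.mul ?_ (hg'.comp (measurable_const.prodMk measurable_id))
        have : Continuous fun q : (Fin k → ℂ) × (Fin N → ℂ) =>
            (rootPoly q.1 * coeffPoly q.2).eval w := by
          simp only [eval_mul, rootPoly, eval_prod, eval_sub, eval_X, eval_C]
          refine Continuous.mul (by fun_prop) ?_
          exact continuous_coeffPoly_eval.comp (continuous_snd.prodMk continuous_const)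
        exact (this.norm.pow 2).measurable.ennreal_ofReal
    · refine Measurable.lintegral_prod_right ?_
      exact (continuous_rootWeight.measurable.ennreal_ofReal).mul hg

end RootSum

/-! ### Almost sure simplicity of the roots -/

section SimpleRoots

open Polynomial

variable {N k M : ℕ}

/-- Almost every `a` is a regular value of `(w, Q) ↦ (X - w) Q`. As the Jacobian is `-Q(w)`,
regularity says that no root survives in its own cofactor, i.e. all roots are simple; the zero
polynomial is a critical value. -/
theorem ae_coeffPoly_nodup_roots :
    ∀ᵐ a : Fin (M + 1) → ℂ, coeffPoly a ≠ 0 ∧ (coeffPoly a).roots.Nodup := by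
  filter_upwards [ae_forall_det_ne_zero (volume : Measure (Fin (M + 1) → ℂ))
    (hasFDerivAt_linearFactorMul (N := M))] with a ha
  simp only [Matrix.det_toRealCLM, det_linearFactorJac, ne_eq, pow_eq_zero_iff two_ne_zero,
    norm_eq_zero, neg_eq_zero] at ha
  have key : ∀ (w : ℂ) (b : Fin M → ℂ), coeffPoly a = (X - C w) * coeffPoly b →
      (coeffPoly b).eval w ≠ 0 := by
    intro w b h
    have := ha (Fin.cons w b) (coeffPoly_injective (by rw [coeffPoly_linearFactorMul, h]; simp))
    simpa using this
  have h0 : coeffPoly a ≠ 0 := by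
    intro h
    have hz : coeffPoly (0 : Fin M → ℂ) = 0 := by simp [coeffPoly]
    exact key 0 0 (by rw [h, hz, mul_zero]) (by simp [hz])
  refine ⟨h0, Multiset.nodup_iff_count_le_one.2 fun w => ?_⟩
  rw [count_roots]
  by_contra! hlt
  obtain ⟨R, hR⟩ := (le_rootMultiplicity_iff h0).1 hlt
  replace hR : coeffPoly a = (X - C w) * ((X - C w) * R) := by
    rw [hR, ← mul_assoc, ← sq]
  have hne : (X - C w) * R ≠ 0 := by
    rintro h
    exact h0 (by rw [hR, h, mul_zero])
  have hd : ((X - C w) * R).degree < (M : WithBot ℕ) := by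
    have h2 := coeffPoly_degree_lt a
    rw [hR, degree_mul, degree_X_sub_C, degree_eq_natDegree hne] at h2
    rw [degree_eq_natDegree hne]
    have h3 : 1 + ((X - C w) * R).natDegree < M + 1 := by exact_mod_cast h2
    exact_mod_cast (by omega : ((X - C w) * R).natDegree < M)
  refine key w (fun i => ((X - C w) * R).coeff i) ?_ ?_
  · rw [coeffPoly_coeff_eq hd, hR]
  · rw [coeffPoly_coeff_eq hd]
    simp

theorem rootPoly_eq_multiset_prod (z : Fin k → ℂ) :
    rootPoly z = ((Finset.univ.val.map z).map fun w => X - C w).prod := by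
  rw [Multiset.map_map]
  rfl

theorem rootPoly_dvd_iff {p : ℂ[X]} (hp : p ≠ 0) (hn : p.roots.Nodup) (z : Fin k → ℂ) :
    rootPoly z ∣ p ↔ Function.Injective z ∧ ∀ i, z i ∈ p.roots := by
  rw [rootPoly_eq_multiset_prod, Multiset.prod_X_sub_C_dvd_iff_le_roots hp]
  constructor
  · intro h
    refine ⟨?_, fun i => Multiset.mem_of_le h (Multiset.mem_map_of_mem z (Finset.mem_univ_val i))⟩
    have := Multiset.inj_on_of_nodup_map (Multiset.nodup_of_le h hn)
    exact fun i j hij => this i (Finset.mem_univ_val i) j (Finset.mem_univ_val j) hij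
  · rintro ⟨hi, hm⟩
    rw [Multiset.le_iff_subset (Multiset.Nodup.map hi Finset.univ.nodup)]
    intro w hw
    obtain ⟨i, _, rfl⟩ := Multiset.mem_map.1 hw
    exact hm i

/-- For a polynomial with simple roots every factorization is a regular point, so the nonvanishing
condition in `rootSum` costs nothing. -/
theorem rootWeight_ne_zero {p : ℂ[X]} (hp : p ≠ 0) (hn : p.roots.Nodup) {z : Fin k → ℂ}
    {b : Fin N → ℂ} (h : p = rootPoly z * coeffPoly b) : rootWeight z b ≠ 0 := by
  have hi := ((rootPoly_dvd_iff hp hn z).1 ⟨_, h⟩).1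
  have hb : coeffPoly b ≠ 0 := by
    rintro h0
    exact hp (by rw [h, h0, mul_zero])
  have hr : p.roots = Finset.univ.val.map z + (coeffPoly b).roots := by
    rw [h, roots_mul (h ▸ hp), rootPoly_eq_multiset_prod, roots_multiset_prod_X_sub_C]
  rw [hr, Multiset.nodup_add] at hn
  rw [rootWeight, mul_ne_zero_iff, Finset.prod_ne_zero_iff]
  refine ⟨?_, fun i _ => ?_⟩
  · rw [pow_ne_zero_iff two_ne_zero, norm_ne_zero_iff, Matrix.det_vandermonde_ne_zero_iff]
    exact hi
  · rw [pow_ne_zero_iff two_ne_zero, norm_ne_zero_iff]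
    intro h0
    refine Multiset.disjoint_left.1 hn.2.2 (Multiset.mem_map_of_mem z (Finset.mem_univ_val i)) ?_
    exact (mem_roots hb).2 h0

open Classical in
-- Elements of `s.ToType` are values with a copy index. Without repetitions the index carries no
-- information, so embeddings correspond to injective tuples of elements of `s`.
theorem sumDistinct_eq_tsum {s : Multiset ℂ} (hs : s.Nodup) (φ : (Fin k → ℂ) → ℝ≥0∞) :
    sumDistinct k s φ =
      ∑' z : Fin k → ℂ, if Function.Injective z ∧ ∀ i, z i ∈ s then φ z else 0 := by
  have hinj : Function.Injective fun x : s.ToType => x.1 := by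
    rintro ⟨x, p⟩ ⟨y, q⟩ h
    obtain rfl : x = y := h
    have h1 := Multiset.nodup_iff_count_le_one.1 hs x
    have hp := p.2
    have hq := q.2
    congr 1
    ext
    omega
  let F : (Fin k ↪ s.ToType) → Fin k → ℂ := fun e j => (e j).1
  have hF : Function.Injective F := by
    intro e e' h
    ext1 j
    exact hinj (congrFun h j)
  have hmem : ∀ e, Function.Injective (F e) ∧ ∀ i, F e i ∈ s := fun e =>
    ⟨hinj.comp e.injective, fun i => Multiset.coe_mem⟩
  rw [sumDistinct, ← tsum_fintype (L := .unconditional _), ← hF.tsum_eq]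
  · exact tsum_congr fun e => (if_pos (hmem e)).symm
  · intro z hz
    rw [Function.mem_support, ne_eq, ite_eq_right_iff, not_forall] at hz
    obtain ⟨⟨h1, h2⟩, -⟩ := hz
    exact ⟨⟨fun i => ⟨z i, ⟨0, Multiset.count_pos.2 (h2 i)⟩⟩, fun i j hij =>
      h1 (congrArg Sigma.fst hij)⟩, rfl⟩

/-- A tuple of distinct roots is a tuple `z` with `rootPoly z` dividing the polynomial, and the
cofactor is then unique. -/
theorem sumDistinct_roots_eq_rootSum (hM : M = N + k) {a : Fin M → ℂ} (h0 : coeffPoly a ≠ 0)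
    (hn : (coeffPoly a).roots.Nodup) (φ : (Fin k → ℂ) → ℝ≥0∞) :
    sumDistinct k (coeffPoly a).roots φ =
      rootSum k (fun z (_ : Fin N → ℂ) => φ z) a := by
  classical
  rw [sumDistinct_eq_tsum hn, rootSum]
  refine tsum_congr fun z => ?_
  simp only [← rootPoly_dvd_iff h0 hn]
  split_ifs with h
  · obtain ⟨q, hq⟩ := h
    have hd : q.degree < N := by
      have hq0 : q ≠ 0 := by
        rintro rfl
        exact h0 (by rw [hq, mul_zero])
      have h1 := coeffPoly_degree_lt a
      rw [hq, degree_mul, rootPoly_degree, degree_eq_natDegree hq0] at h1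
      rw [degree_eq_natDegree hq0]
      have h3 : k + q.natDegree < M := by exact_mod_cast h1
      exact_mod_cast (by omega : q.natDegree < N)
    have hq' : coeffPoly a = rootPoly z * coeffPoly fun i : Fin N => q.coeff i := by
      rw [coeffPoly_coeff_eq hd, hq]
    rw [tsum_eq_single fun i : Fin N => q.coeff i, if_pos ⟨rootWeight_ne_zero h0 hn hq', hq'⟩]
    exact fun b hb => if_neg fun h => hb (rootPoly_mul_inj (h.2.symm.trans hq'))
  · rw [eq_comm, ENNReal.tsum_eq_zero]
    exact fun b => if_neg fun h' => h ⟨_, h'.2⟩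

end SimpleRoots

/-! ### Gaussian coefficient vectors -/

section GaussianVector

variable {M : ℕ}

/-- The density of a vector of independent standard complex Gaussians. -/
noncomputable def gaussDensity (a : Fin M → ℂ) : ℝ :=
  Real.exp (-∑ i, ‖a i‖ ^ 2) / Real.pi ^ M

theorem gaussDensity_nonneg (a : Fin M → ℂ) : 0 ≤ gaussDensity a := by
  unfold gaussDensity
  positivity

theorem continuous_gaussDensity : Continuous (gaussDensity : (Fin M → ℂ) → ℝ) := by
  unfold gaussDensity
  fun_prop

theorem measurable_stdDensity :
    Measurable fun z : ℂ => ENNReal.ofReal (Real.exp (-‖z‖ ^ 2) / Real.pi) := by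
  fun_prop

theorem ofReal_gaussDensity (a : Fin M → ℂ) :
    ENNReal.ofReal (gaussDensity a) =
      ∏ i, ENNReal.ofReal (Real.exp (-‖a i‖ ^ 2) / Real.pi) := by
  rw [← ENNReal.ofReal_prod_of_nonneg fun i _ => by positivity]
  simp [gaussDensity, Finset.prod_div_distrib, ← Real.exp_sum]

theorem lintegral_pi_prod {f : Fin M → ℂ → ℝ≥0∞} (hf : ∀ i, Measurable (f i)) :
    ∫⁻ a : Fin M → ℂ, ∏ i, f i (a i) = ∏ i, ∫⁻ z, f i z := by
  induction M with
  | zero => simp [volume_pi]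
  | succ M ih =>
    rw [lintegral_fin_cons]
    · simp only [Fin.prod_univ_succ, Fin.cons_zero, Fin.cons_succ]
      rw [← ih fun i => hf i.succ, ← lintegral_mul_const _ (hf 0)]
      refine lintegral_congr fun w => ?_
      rw [lintegral_const_mul]
      exact Finset.measurable_fun_prod _ fun i _ => (hf i.succ).comp (measurable_pi_apply i)
    · exact Finset.measurable_fun_prod _ fun i _ => (hf i).comp (measurable_pi_apply i)

instance : SigmaFinite stdComplexGaussian := by
  unfold stdComplexGaussian
  infer_instance

theorem pi_stdComplexGaussian :
    Measure.pi (fun _ : Fin M => stdComplexGaussian) =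
      (volume : Measure (Fin M → ℂ)).withDensity fun a => ENNReal.ofReal (gaussDensity a) := by
  refine Measure.pi_eq fun s hs => ?_
  rw [withDensity_apply _ (MeasurableSet.univ_pi hs),
    ← lintegral_indicator (MeasurableSet.univ_pi hs)]
  have h : ∀ a : Fin M → ℂ, (Set.univ.pi s).indicator
      (fun a => ENNReal.ofReal (gaussDensity a)) a =
      ∏ i, (s i).indicator (fun z => ENNReal.ofReal (Real.exp (-‖z‖ ^ 2) / Real.pi)) (a i) := by
    intro a
    by_cases ha : a ∈ Set.univ.pi s
    · rw [Set.indicator_of_mem ha, ofReal_gaussDensity]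
      exact Finset.prod_congr rfl fun i _ =>
        (Set.indicator_of_mem (ha i (Set.mem_univ i))
          fun z => ENNReal.ofReal (Real.exp (-‖z‖ ^ 2) / Real.pi)).symm
    · rw [Set.indicator_of_notMem ha]
      simp only [Set.mem_pi, Set.mem_univ, true_implies, not_forall] at ha
      obtain ⟨i, hi⟩ := ha
      exact (Finset.prod_eq_zero (Finset.mem_univ i) (Set.indicator_of_notMem hi _)).symm
  simp_rw [h]
  rw [lintegral_pi_prod fun i => measurable_stdDensity.indicator (hs i)]
  refine Finset.prod_congr rfl fun i _ => ?_
  rw [lintegral_indicator (hs i), stdComplexGaussian, withDensity_apply _ (hs i)]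

variable {Ω : Type*} [MeasurableSpace Ω] {P : Measure Ω} {G : ℕ → Ω → ℂ}

theorem map_gaussian (hlaw : ∀ i, HasLaw (G i) stdComplexGaussian P) (hindep : iIndepFun G P)
    {u : Fin M → ℕ} (hu : Function.Injective u) :
    P.map (fun ω i => G (u i) ω) =
      (volume : Measure (Fin M → ℂ)).withDensity fun a => ENNReal.ofReal (gaussDensity a) := by
  rw [(hindep.precomp hu).map_fun_eq_pi_map fun i => (hlaw (u i)).aemeasurable,
    ← pi_stdComplexGaussian]
  simp only [(hlaw _).map_eq]

/-- Lebesgue a.e. measurability suffices because the Gaussian law is absolutely continuous. This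
matters for `sumDistinct` of the roots, which is compared with the measurable `rootSum` only almost
everywhere. The injection `u` selects all coefficients, or only those of index at least `k`. -/
theorem lintegral_gaussian (hlaw : ∀ i, HasLaw (G i) stdComplexGaussian P)
    (hindep : iIndepFun G P) {u : Fin M → ℕ} (hu : Function.Injective u)
    {F : (Fin M → ℂ) → ℝ≥0∞} (hF : AEMeasurable F) :
    ∫⁻ ω, F (fun i => G (u i) ω) ∂P = ∫⁻ a, ENNReal.ofReal (gaussDensity a) * F a := by
  have hd : Measurable fun a : Fin M → ℂ => ENNReal.ofReal (gaussDensity a) :=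
    continuous_gaussDensity.measurable.ennreal_ofReal
  have hX : AEMeasurable (fun ω (i : Fin M) => G (u i) ω) P :=
    aemeasurable_pi_lambda _ fun i => (hlaw (u i)).aemeasurable
  rw [← lintegral_map' (f := F) ?_ hX, map_gaussian hlaw hindep hu,
    lintegral_withDensity_eq_lintegral_mul₀ hd.aemeasurable hF]
  · rfl
  · rw [map_gaussian hlaw hindep hu]
    exact hF.mono_ac (withDensity_absolutelyContinuous _ _)

theorem kacPolynomial_eq_coeffPoly (n : ℕ) (a : ℕ → ℂ) :
    kacPolynomial n a = coeffPoly fun i : Fin (n + 1) => a i := by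
  rw [kacPolynomial, coeffPoly, Finset.sum_range]

/-- The correlation functions of the roots, as an integral over the cofactor of the roots. -/
theorem lintegral_sumDistinct {n N k : ℕ} (hN : n + 1 = N + k)
    (hlaw : ∀ i, HasLaw (G i) stdComplexGaussian P) (hindep : iIndepFun G P)
    {φ : (Fin k → ℂ) → ℝ≥0∞} (hφ : Measurable φ) :
    ∫⁻ ω, sumDistinct k (kacPolynomial n fun i => G i ω).roots φ ∂P =
      ∫⁻ z, φ z * ∫⁻ b : Fin N → ℂ, ENNReal.ofReal (rootWeight z b) *
        ENNReal.ofReal (gaussDensity fun i : Fin (n + 1) =>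
          (rootPoly z * coeffPoly b).coeff i) := by
  have hae : (fun a : Fin (n + 1) → ℂ => sumDistinct k (coeffPoly a).roots φ) =ᵐ[volume]
      fun a => rootSum k (fun z (_ : Fin N → ℂ) => φ z) a := by
    filter_upwards [ae_coeffPoly_nodup_roots] with a ha
    exact sumDistinct_roots_eq_rootSum hN ha.1 ha.2 φ
  have hm : Measurable fun a : Fin (n + 1) → ℂ => rootSum k (fun z (_ : Fin N → ℂ) => φ z) a := by
    have h := measurable_rootSum (Y := Unit) hN (g := fun _ z (_ : Fin N → ℂ) => φ z)
      (hφ.comp (measurable_fst.comp measurable_snd))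
    have h' := h.comp (f := fun a => ((), a)) (measurable_const.prodMk measurable_id)
    exact h'
  have hg : Continuous fun q : (Fin k → ℂ) × (Fin N → ℂ) =>
      gaussDensity fun i : Fin (n + 1) => (rootPoly q.1 * coeffPoly q.2).coeff i :=
    continuous_gaussDensity.comp (continuous_pi fun i => continuous_coeff_rootPoly_mul i)
  simp_rw [kacPolynomial_eq_coeffPoly]
  rw [lintegral_gaussian hlaw hindep (u := fun i : Fin (n + 1) => (i : ℕ))
    (F := fun a => sumDistinct k (coeffPoly a).roots φ) Fin.val_injective
    (hm.aemeasurable.congr hae.symm)]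
  rw [lintegral_congr_ae (g := fun a => ENNReal.ofReal (gaussDensity a) *
    rootSum k (fun z (_ : Fin N → ℂ) => φ z) a)]
  · have hmul := fun a : Fin (n + 1) → ℂ =>
      mul_rootSum (fun a => ENNReal.ofReal (gaussDensity a)) (fun z (_ : Fin N → ℂ) => φ z) a
    simp_rw [hmul]
    rw [lintegral_rootSum hN]
    · refine lintegral_congr fun z => ?_
      rw [← lintegral_const_mul]
      · refine lintegral_congr fun b => ?_
        ring
      · refine (Measurable.ennreal_ofReal ?_).mul (Measurable.ennreal_ofReal ?_)
        · exact (continuous_rootWeight.comp (Continuous.prodMk_right z)).measurable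
        · exact (hg.comp (Continuous.prodMk_right z)).measurable
    · exact hg.measurable.ennreal_ofReal.mul (hφ.comp measurable_fst)
  · filter_upwards [hae] with a ha
    rw [ha]

end GaussianVector

/-! ### Uniform bounds for division by `rootPoly` -/

section PolynomialDivision

open Polynomial

variable {k : ℕ} {θ y : ℝ}

/-- The weighted `ℓ¹` norm of the coefficients of a polynomial. -/
noncomputable def weightedNorm (θ : ℝ) (f : ℂ[X]) : ℝ :=
  ∑ i ∈ Finset.range (f.natDegree + 1), ‖f.coeff i‖ * θ ^ i

theorem weightedNorm_eq {f : ℂ[X]} {n : ℕ} (h : f.natDegree < n) :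
    weightedNorm θ f = ∑ i ∈ Finset.range n, ‖f.coeff i‖ * θ ^ i := by
  refine Finset.sum_subset (Finset.range_subset_range.2 h) fun i _ hi => ?_
  rw [coeff_eq_zero_of_natDegree_lt (by simpa using hi), norm_zero, zero_mul]

theorem weightedNorm_nonneg (hθ : 0 ≤ θ) (f : ℂ[X]) : 0 ≤ weightedNorm θ f :=
  Finset.sum_nonneg fun _ _ => by positivity

theorem norm_eval_le_weightedNorm (f : ℂ[X]) {w : ℂ} (hw : ‖w‖ ≤ θ) :
    ‖f.eval w‖ ≤ weightedNorm θ f := by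
  rw [eval_eq_sum_range]
  refine (norm_sum_le _ _).trans (Finset.sum_le_sum fun i _ => ?_)
  rw [norm_mul, norm_pow]
  gcongr

theorem norm_coeff_le_weightedNorm (hθ : 0 ≤ θ) (f : ℂ[X]) (i : ℕ) :
    ‖f.coeff i‖ * θ ^ i ≤ weightedNorm θ f := by
  rw [weightedNorm_eq (n := f.natDegree + i + 1) (by omega)]
  exact Finset.single_le_sum (f := fun i => ‖f.coeff i‖ * θ ^ i) (fun _ _ => by positivity)
    (Finset.mem_range.2 (by omega))

theorem weightedNorm_X_pow (m : ℕ) : weightedNorm θ (X ^ m) = θ ^ m := by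
  rw [weightedNorm_eq (n := m + 1) (by simp)]
  simp [coeff_X_pow, Finset.sum_range_succ]
  exact Finset.sum_eq_zero fun i hi => by
    rw [if_neg (Finset.mem_range.1 hi).ne, norm_zero, zero_mul]

theorem weightedNorm_C_add_X_sub_C_mul (hθ : 0 ≤ θ) (c w : ℂ) (f : ℂ[X]) :
    weightedNorm θ (C c + (X - C w) * f) ≤ ‖c‖ + (θ + ‖w‖) * weightedNorm θ f := by
  have hd : (C c + (X - C w) * f).natDegree < f.natDegree + 2 := by
    refine Nat.lt_succ_of_le ((natDegree_add_le _ _).trans ?_)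
    have := natDegree_mul_le (p := X - C w) (q := f)
    simp only [natDegree_X_sub_C, natDegree_C] at this ⊢
    omega
  rw [weightedNorm_eq hd, Finset.sum_range_succ', weightedNorm_eq (n := f.natDegree + 2) (by omega)]
  have h1 : ∀ i, ‖(C c + (X - C w) * f).coeff (i + 1)‖ * θ ^ (i + 1) ≤
      θ * (‖f.coeff i‖ * θ ^ i) + ‖w‖ * (‖f.coeff (i + 1)‖ * θ ^ (i + 1)) := by
    intro i
    have : (C c + (X - C w) * f).coeff (i + 1) = f.coeff i - w * f.coeff (i + 1) := by
      simp [sub_mul]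
    rw [this]
    calc _ ≤ (‖f.coeff i‖ + ‖w‖ * ‖f.coeff (i + 1)‖) * θ ^ (i + 1) := by
          gcongr
          exact (norm_sub_le _ _).trans (by rw [norm_mul])
      _ = _ := by ring
  have h0 : ‖(C c + (X - C w) * f).coeff 0‖ * θ ^ 0 ≤ ‖c‖ + ‖w‖ * (‖f.coeff 0‖ * θ ^ 0) := by
    have : (C c + (X - C w) * f).coeff 0 = c - w * f.coeff 0 := by
      simp [sub_mul]
      ring
    rw [this, pow_zero, mul_one, mul_one]
    exact (norm_sub_le _ _).trans (by rw [norm_mul])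
  refine (add_le_add (Finset.sum_le_sum fun i _ => h1 i) h0).trans ?_
  rw [Finset.sum_add_distrib, ← Finset.mul_sum, ← Finset.mul_sum, add_mul]
  have h2 : ∑ i ∈ Finset.range (f.natDegree + 1), ‖f.coeff i‖ * θ ^ i ≤
      ∑ i ∈ Finset.range (f.natDegree + 2), ‖f.coeff i‖ * θ ^ i := by
    rw [Finset.sum_range_succ _ (f.natDegree + 1)]
    exact le_add_of_nonneg_right (by positivity)
  have h3 := Finset.sum_range_succ' (fun i => ‖f.coeff i‖ * θ ^ i) (f.natDegree + 1)
  have h4 := mul_le_mul_of_nonneg_left h2 hθ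
  rw [h3] at h4 ⊢
  linarith

/-- Horner's recursion `q_i = f_{i+1} + w q_{i+1}`, summed with weights `θ ^ (i + 1)`, gives `θ ‖q‖
≤ ‖f‖ + ‖w‖ ‖q‖`. -/
theorem weightedNorm_divByMonic_le (hθ : 0 ≤ θ) (f : ℂ[X]) (w : ℂ) :
    (θ - ‖w‖) * weightedNorm θ (f /ₘ (X - C w)) ≤ weightedNorm θ f := by
  set q := f /ₘ (X - C w) with hq
  have hd : q.natDegree ≤ f.natDegree := by
    rw [hq, natDegree_divByMonic _ (monic_X_sub_C w)]
    exact Nat.sub_le _ _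
  set n := f.natDegree + 1
  have h1 : ∀ i, θ * (‖q.coeff i‖ * θ ^ i) ≤
      ‖f.coeff (i + 1)‖ * θ ^ (i + 1) + ‖w‖ * (‖q.coeff (i + 1)‖ * θ ^ (i + 1)) := by
    intro i
    have : q.coeff i = f.coeff (i + 1) + w * q.coeff (i + 1) := coeff_divByMonic_X_sub_C_rec f w i
    calc _ = ‖q.coeff i‖ * θ ^ (i + 1) := by ring
      _ ≤ (‖f.coeff (i + 1)‖ + ‖w‖ * ‖q.coeff (i + 1)‖) * θ ^ (i + 1) := by
          gcongr
          rw [this]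
          exact (norm_add_le _ _).trans (by rw [norm_mul])
      _ = _ := by ring
  have h2 := Finset.sum_le_sum fun i (_ : i ∈ Finset.range n) => h1 i
  rw [Finset.sum_add_distrib, ← Finset.mul_sum, ← Finset.mul_sum,
    ← weightedNorm_eq (Nat.lt_succ_of_le hd)] at h2
  have h3 := Finset.sum_range_succ' (fun i => ‖f.coeff i‖ * θ ^ i) n
  have h4 := Finset.sum_range_succ' (fun i => ‖q.coeff i‖ * θ ^ i) n
  rw [← weightedNorm_eq (by omega)] at h3 h4
  have h5 : 0 ≤ ‖f.coeff 0‖ * θ ^ 0 := by positivity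
  have h6 : 0 ≤ ‖w‖ * (‖q.coeff 0‖ * θ ^ 0) := by positivity
  have h7 := congrArg (‖w‖ * ·) h4
  simp only [mul_add] at h7
  linarith

/-- Write `f = f(w) + (X - w) f₁` and divide `f₁` by `p`. -/
theorem div_mod_X_sub_C_mul (f : ℂ[X]) (w : ℂ) {p : ℂ[X]} (hp : p.Monic) :
    f /ₘ ((X - C w) * p) = (f /ₘ (X - C w)) /ₘ p ∧
    f %ₘ ((X - C w) * p) = C (f.eval w) + (X - C w) * ((f /ₘ (X - C w)) %ₘ p) := by
  have hm : ((X - C w) * p).Monic := (monic_X_sub_C w).mul hp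
  refine div_modByMonic_unique _ _ hm ⟨?_, ?_⟩
  · have h1 := modByMonic_add_div f (X - C w)
    have h2 := modByMonic_add_div (f /ₘ (X - C w)) p
    rw [modByMonic_X_sub_C_eq_C_eval] at h1
    conv_rhs => rw [← h1]
    rw [add_assoc, mul_assoc, ← mul_add, h2]
  · have h0 : (0 : ℕ) < p.natDegree + 1 := by omega
    have hdeg : ((X - C w) * p).degree = ((p.natDegree + 1 : ℕ) : WithBot ℕ) := by
      rw [degree_mul, degree_X_sub_C, degree_eq_natDegree hp.ne_zero, add_comm]
      rfl
    refine (degree_add_le _ _).trans_lt (max_lt ?_ ?_)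
    · rw [hdeg]
      exact degree_C_le.trans_lt (by exact_mod_cast h0)
    · rw [degree_mul, degree_mul, degree_X_sub_C]
      exact WithBot.add_lt_add_left (by simp) (degree_modByMonic_lt _ hp)

/-- Dividing by one root at a time costs a factor `1 / (θ - y)` each. No separation of the roots
enters, so the bound is uniform up to coinciding points. -/
theorem exists_weightedNorm_div_mod_le (k : ℕ) (hy : y < θ) (hθ : 0 ≤ θ) :
    ∃ K, 0 ≤ K ∧ ∀ z : Fin k → ℂ, (∀ i, ‖z i‖ ≤ y) → ∀ f : ℂ[X],
      weightedNorm θ (f /ₘ rootPoly z) ≤ K * weightedNorm θ f ∧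
      weightedNorm θ (f %ₘ rootPoly z) ≤ K * weightedNorm θ f := by
  induction k with
  | zero =>
    refine ⟨1, zero_le_one, fun z _ f => ?_⟩
    have h1 : rootPoly z = 1 := by simp [rootPoly]
    rw [h1, divByMonic_one, modByMonic_one, one_mul]
    exact ⟨le_rfl, by simpa [weightedNorm] using weightedNorm_nonneg hθ f⟩
  | succ k ih =>
    obtain ⟨K, hK, h⟩ := ih
    have hpos : 0 < θ - y := sub_pos.2 hy
    -- The first two terms bound the remainder `f(w) + (X - w) r`, using `θ + ‖w‖ ≤ 2 θ`; the last
    -- bounds the quotient.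
    refine ⟨1 + 2 * θ * K / (θ - y) + K / (θ - y), by positivity, fun z hz f => ?_⟩
    have hz0 := hz 0
    have hz' : rootPoly z = (X - C (z 0)) * rootPoly (Fin.tail z) := by
      conv_lhs => rw [← Fin.cons_self_tail z, rootPoly_cons]
    obtain ⟨e1, e2⟩ := div_mod_X_sub_C_mul f (z 0) (rootPoly_monic (Fin.tail z))
    obtain ⟨b1, b2⟩ := h (Fin.tail z) (fun i => hz i.succ) (f /ₘ (X - C (z 0)))
    have hf := weightedNorm_nonneg hθ f
    have hq : weightedNorm θ (f /ₘ (X - C (z 0))) ≤ weightedNorm θ f / (θ - y) := by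
      rw [le_div_iff₀ hpos, mul_comm]
      refine le_trans ?_ (weightedNorm_divByMonic_le hθ f (z 0))
      exact mul_le_mul_of_nonneg_right (by linarith) (weightedNorm_nonneg hθ _)
    have hq' := mul_le_mul_of_nonneg_left hq hK
    rw [hz', e1, e2]
    constructor
    · refine (b1.trans hq').trans ?_
      have h3 : 0 ≤ (1 + 2 * θ * K / (θ - y)) * weightedNorm θ f := by positivity
      have h4 : K * (weightedNorm θ f / (θ - y)) = K / (θ - y) * weightedNorm θ f := by ring
      rw [add_mul, h4]
      linarith
    · refine (weightedNorm_C_add_X_sub_C_mul hθ _ _ _).trans ?_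
      have h5 := norm_eval_le_weightedNorm f (hz0.trans hy.le)
      have h6 : (θ + ‖z 0‖) * weightedNorm θ ((f /ₘ (X - C (z 0))) %ₘ rootPoly (Fin.tail z)) ≤
          (2 * θ) * (K * (weightedNorm θ f / (θ - y))) :=
        mul_le_mul (by linarith) (b2.trans hq') (weightedNorm_nonneg hθ _) (by positivity)
      have h7 : 0 ≤ K / (θ - y) * weightedNorm θ f := by positivity
      have h8 : (2 * θ) * (K * (weightedNorm θ f / (θ - y))) =
        2 * θ * K / (θ - y) * weightedNorm θ f := by ring
      have h9 : (1 + 2 * θ * K / (θ - y) + K / (θ - y)) * weightedNorm θ f = weightedNorm θ f +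
        2 * θ * K / (θ - y) * weightedNorm θ f + K / (θ - y) * weightedNorm θ f := by ring
      rw [h9]
      linarith

/-- Geometric bounds for quotients and remainders of monomials. -/
theorem exists_div_mod_X_pow_le (k : ℕ) (hy : y < θ) (hθ : 0 < θ) (hθ1 : θ ≤ 1) :
    ∃ K, 0 ≤ K ∧ ∀ z : Fin k → ℂ, (∀ i, ‖z i‖ ≤ y) → ∀ m : ℕ,
      (∀ i, ‖(X ^ m /ₘ rootPoly z).eval (z i)‖ ≤ K * θ ^ m) ∧
      ∀ j : Fin k, ‖(X ^ m %ₘ rootPoly z).coeff j‖ ≤ K * θ ^ m := by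
  obtain ⟨K, hK, h⟩ := exists_weightedNorm_div_mod_le k hy hθ.le
  -- Reading off a coefficient of index `j < k` from the weighted norm loses `θ ^ (-j) ≤ θ ^ (-k)`.
  refine ⟨K / θ ^ k, by positivity, fun z hz m => ?_⟩
  obtain ⟨h1, h2⟩ := h z hz (X ^ m)
  rw [weightedNorm_X_pow] at h1 h2
  have h3 : K * θ ^ m ≤ K / θ ^ k * θ ^ m := by
    gcongr
    exact le_div_self hK (by positivity) (pow_le_one₀ hθ.le hθ1)
  refine ⟨fun i => ((norm_eval_le_weightedNorm _ ((hz i).trans hy.le)).trans h1).trans h3,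
    fun j => ?_⟩
  have h4 := (norm_coeff_le_weightedNorm hθ.le (X ^ m %ₘ rootPoly z) j).trans h2
  have h5 : θ ^ k ≤ θ ^ (j : ℕ) := pow_le_pow_of_le_one hθ.le hθ1 j.2.le
  rw [div_mul_eq_mul_div, le_div_iff₀ (by positivity)]
  exact (mul_le_mul_of_nonneg_left h5 (norm_nonneg _)).trans h4

/-- The dividend varies with `z` because after one linear factor the next dividend is itself a
quotient. -/
theorem continuous_coeff_divByMonic {Z : Type*} [TopologicalSpace Z] {f : Z → ℂ[X]} {D : ℕ}
    (hD : ∀ z, (f z).natDegree ≤ D) (hf : ∀ j, Continuous fun z => (f z).coeff j)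
    {w : Z → Fin k → ℂ} (hw : Continuous w) (j : ℕ) :
    Continuous fun z => (f z /ₘ rootPoly (w z)).coeff j := by
  induction k generalizing f j with
  | zero =>
    have h1 : ∀ z, rootPoly (w z) = 1 := fun z => by simp [rootPoly]
    simpa only [h1, divByMonic_one] using hf j
  | succ k ih =>
    have hz' : ∀ z, rootPoly (w z) = (X - C (w z 0)) * rootPoly (Fin.tail (w z)) := fun z => by
      conv_lhs => rw [← Fin.cons_self_tail (w z), rootPoly_cons]
    have e := fun z => (div_mod_X_sub_C_mul (f z) (w z 0) (rootPoly_monic (Fin.tail (w z)))).1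
    simp only [hz', e]
    have hd : ∀ z, (f z /ₘ (X - C (w z 0))).natDegree ≤ D := fun z => by
      rw [natDegree_divByMonic _ (monic_X_sub_C _)]
      exact (Nat.sub_le _ _).trans (hD z)
    refine ih hd (fun j => ?_) (w := fun z => Fin.tail (w z))
      (continuous_pi fun i => (continuous_apply i.succ).comp hw) j
    have h0 : Continuous fun z => w z 0 := (continuous_apply 0).comp hw
    -- Descending induction on the index: coefficients above `D` vanish, and Horner's recursion goes
    -- down from there.
    suffices H : ∀ i j, D < j + i → Continuous fun z => (f z /ₘ (X - C (w z 0))).coeff j from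
      H (D + 1) j (by omega)
    intro i
    induction i with
    | zero =>
      intro j hj
      have : ∀ z, (f z /ₘ (X - C (w z 0))).coeff j = 0 := fun z =>
        coeff_eq_zero_of_natDegree_lt ((hd z).trans_lt hj)
      simpa only [this] using continuous_const
    | succ i ih' =>
      intro j hj
      simp only [coeff_divByMonic_X_sub_C_rec (f _) _ j]
      exact (hf (j + 1)).add (h0.mul (ih' (j + 1) (by omega)))

theorem continuous_quotient_coeff (m j : ℕ) :
    Continuous fun z : Fin k → ℂ => ((X ^ m : ℂ[X]) /ₘ rootPoly z).coeff j :=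
  continuous_coeff_divByMonic (f := fun _ => X ^ m) (D := m) (fun _ => by simp)
    (fun _ => continuous_const) continuous_id j

theorem continuous_quotient_eval (m : ℕ) (i : Fin k) :
    Continuous fun z : Fin k → ℂ => ((X ^ m : ℂ[X]) /ₘ rootPoly z).eval (z i) := by
  have h : ∀ z : Fin k → ℂ, ((X ^ m : ℂ[X]) /ₘ rootPoly z).natDegree < m + 1 := fun z => by
    rw [natDegree_divByMonic _ (rootPoly_monic z), natDegree_X_pow]
    omega
  simp only [fun z => eval_eq_sum_range' (h z)]
  exact continuous_finsetSum _ fun j _ =>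
    (continuous_quotient_coeff m j).mul ((continuous_apply i).pow j)

theorem continuous_remainder_coeff (m j : ℕ) :
    Continuous fun z : Fin k → ℂ => ((X ^ m : ℂ[X]) %ₘ rootPoly z).coeff j := by
  simp only [fun z : Fin k → ℂ => modByMonic_eq_sub_mul_div (X ^ m : ℂ[X]) (rootPoly z),
    coeff_sub, coeff_mul]
  exact continuous_const.sub (continuous_finsetSum _ fun q _ =>
    (continuous_coeff_rootPoly _).mul (continuous_quotient_coeff m _))

end PolynomialDivision

/-! ### High coefficients as coordinates on the cofactor -/

section TailCoordinates

open Polynomial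

variable {N k M : ℕ}

/-- The matrix sending `b` to the coefficients of index at least `k` of
`rootPoly z * coeffPoly b`. -/
noncomputable def tailMatrix (N : ℕ) (z : Fin k → ℂ) : Matrix (Fin N) (Fin N) ℂ :=
  Matrix.of fun j l => (rootPoly z * X ^ (l : ℕ)).coeff (j + k)

theorem det_tailMatrix (z : Fin k → ℂ) : (tailMatrix N z).det = 1 := by
  rw [Matrix.det_of_isUpperTriangular]
  · refine Finset.prod_eq_one fun i _ => ?_
    have h := (rootPoly_monic z).coeff_natDegree
    rw [rootPoly_natDegree] at h
    rw [tailMatrix, Matrix.of_apply, add_comm, coeff_mul_X_pow, h]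
  · intro i j hij
    have h1 : (j : ℕ) < i := hij
    rw [tailMatrix, Matrix.of_apply, coeff_mul_X_pow', if_pos (by omega),
      coeff_eq_zero_of_natDegree_lt]
    rw [rootPoly_natDegree]
    omega

theorem tailMatrix_mulVec (z : Fin k → ℂ) (b : Fin N → ℂ) (j : Fin N) :
    (tailMatrix N z).mulVec b j = (rootPoly z * coeffPoly b).coeff (j + k) := by
  rw [coeffPoly, Finset.mul_sum, finsetSum_coeff, Matrix.mulVec, dotProduct]
  refine Finset.sum_congr rfl fun l _ => ?_
  rw [mul_left_comm, coeff_C_mul, mul_comm]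
  rfl

/-- The quotient of `X ^ k * coeffPoly t` by `rootPoly z`. -/
noncomputable def tailQuotient (z : Fin k → ℂ) (t : Fin N → ℂ) : ℂ[X] :=
  ∑ m, C (t m) * (X ^ (k + m) /ₘ rootPoly z)

/-- The remainder of `X ^ k * coeffPoly t` modulo `rootPoly z`. -/
noncomputable def tailRemainder (z : Fin k → ℂ) (t : Fin N → ℂ) : ℂ[X] :=
  ∑ m, C (t m) * (X ^ (k + m) %ₘ rootPoly z)

theorem rootPoly_mul_tailQuotient (z : Fin k → ℂ) (t : Fin N → ℂ) :
    rootPoly z * tailQuotient z t = X ^ k * coeffPoly t - tailRemainder z t := by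
  rw [tailQuotient, tailRemainder, coeffPoly, Finset.mul_sum, Finset.mul_sum,
    ← Finset.sum_sub_distrib]
  refine Finset.sum_congr rfl fun m _ => ?_
  have h := modByMonic_add_div (X ^ (k + (m : ℕ)) : ℂ[X]) (rootPoly z)
  have hp : (X : ℂ[X]) ^ (k + (m : ℕ)) = X ^ k * X ^ (m : ℕ) := pow_add _ _ _
  rw [hp] at h ⊢
  linear_combination C (t m) * h

theorem tailRemainder_degree_lt (z : Fin k → ℂ) (t : Fin N → ℂ) :
    (tailRemainder z t).degree < k := by
  rw [degree_lt_iff_coeff_zero]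
  intro j hj
  rw [tailRemainder, finsetSum_coeff]
  refine Finset.sum_eq_zero fun m _ => ?_
  rw [coeff_C_mul, coeff_eq_zero_of_degree_lt, mul_zero]
  refine (degree_modByMonic_lt _ (rootPoly_monic z)).trans_le ?_
  rw [rootPoly_degree]
  exact_mod_cast hj

theorem tailQuotient_degree_lt (z : Fin k → ℂ) (t : Fin N → ℂ) :
    (tailQuotient z t).degree < N := by
  rw [degree_lt_iff_coeff_zero]
  intro j hj
  rw [tailQuotient, finsetSum_coeff]
  refine Finset.sum_eq_zero fun m _ => ?_
  rw [coeff_C_mul, coeff_eq_zero_of_natDegree_lt, mul_zero]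
  rw [natDegree_divByMonic _ (rootPoly_monic z), natDegree_X_pow, rootPoly_natDegree]
  omega

/-- `rootPoly z * coeffPoly b` and `X ^ k * coeffPoly t` agree in degrees at least `k`. Hence
`rootPoly z` times the difference of the two cofactors has degree below `k`, which forces it to be
zero. -/
theorem tailQuotient_mulVec (z : Fin k → ℂ) (b : Fin N → ℂ) :
    tailQuotient z ((tailMatrix N z).mulVec b) = coeffPoly b := by
  set t := (tailMatrix N z).mulVec b
  have h : (rootPoly z * (tailQuotient z t - coeffPoly b)).degree < k := by
    rw [mul_sub, rootPoly_mul_tailQuotient, degree_lt_iff_coeff_zero]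
    intro j hj
    obtain ⟨i, rfl⟩ := Nat.exists_eq_add_of_le' hj
    have h1 : (tailRemainder z t).coeff (i + k) = 0 :=
      coeff_eq_zero_of_degree_lt
        ((tailRemainder_degree_lt z t).trans_le (by exact_mod_cast Nat.le_add_left k i))
    rw [coeff_sub, coeff_sub, h1, sub_zero, coeff_X_pow_mul]
    rcases lt_or_ge i N with hi | hi
    · rw [coeffPoly_coeff t ⟨i, hi⟩]
      exact sub_eq_zero.2 (tailMatrix_mulVec z b ⟨i, hi⟩)
    · rw [coeffPoly_coeff_of_le _ hi, zero_sub, neg_eq_zero]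
      exact coeff_eq_zero_of_degree_lt ((rootPoly_mul_degree_lt z b).trans_le
        (by exact_mod_cast Nat.add_le_add_right hi k))
  by_contra hne
  have hne' := sub_ne_zero.2 hne
  rw [degree_mul, rootPoly_degree, degree_eq_natDegree hne'] at h
  have h' : k + (tailQuotient z t - coeffPoly b).natDegree < k := by exact_mod_cast h
  omega

theorem lintegral_tailQuotient (z : Fin k → ℂ) (H : (Fin N → ℂ) → ℝ≥0∞) :
    ∫⁻ b, H b = ∫⁻ t : Fin N → ℂ, H fun i => (tailQuotient z t).coeff i := by
  rw [lintegral_mulVec (tailMatrix N z) (by rw [det_tailMatrix]; exact one_ne_zero)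
    fun t => H fun i => (tailQuotient z t).coeff i]
  simp [det_tailMatrix, tailQuotient_mulVec, coeffPoly_coeff]

/-- The coefficients of the product are those of minus the remainder below index `k`, and those of
`t` from `k` on. -/
theorem gaussDensity_tail (hM : M = N + k) (z : Fin k → ℂ) (t : Fin N → ℂ) :
    gaussDensity (fun i : Fin M => (rootPoly z * tailQuotient z t).coeff i) =
      gaussDensity t * (Real.exp (-∑ j : Fin k, ‖(tailRemainder z t).coeff j‖ ^ 2) /
        Real.pi ^ k) := by
  subst hM
  have h : ∑ i : Fin (N + k), ‖(rootPoly z * tailQuotient z t).coeff i‖ ^ 2 =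
      ∑ j : Fin k, ‖(tailRemainder z t).coeff j‖ ^ 2 + ∑ m, ‖t m‖ ^ 2 := by
    rw [Fin.sum_univ_eq_sum_range fun i => ‖(rootPoly z * tailQuotient z t).coeff i‖ ^ 2,
      add_comm N k, Finset.sum_range_add, Finset.sum_range, Finset.sum_range,
      rootPoly_mul_tailQuotient]
    congr 1
    · refine Finset.sum_congr rfl fun j _ => ?_
      rw [coeff_sub, coeff_X_pow_mul', if_neg (by omega), zero_sub, norm_neg]
    · refine Finset.sum_congr rfl fun m _ => ?_
      have h1 : (tailRemainder z t).coeff (k + m) = 0 :=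
        coeff_eq_zero_of_degree_lt
          ((tailRemainder_degree_lt z t).trans_le (by exact_mod_cast Nat.le_add_right k m))
      rw [coeff_sub, h1, sub_zero, coeff_X_pow_mul', if_pos (by omega), Nat.add_sub_cancel_left,
        coeffPoly_coeff]
  rw [gaussDensity, gaussDensity, h, neg_add, Real.exp_add, pow_add]
  field_simp

/-- The coefficients of `x` in the value at `z i` of the quotient of `∑ x m X ^ (k + m)` by
`rootPoly z`. -/
noncomputable def quotientCoeff (z : Fin k → ℂ) (i : Fin k) (m : ℕ) : ℂ :=
  ((X ^ (k + m) : ℂ[X]) /ₘ rootPoly z).eval (z i)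

/-- The coefficients of `x` in the remainder of `∑ x m X ^ (k + m)` modulo `rootPoly z`. -/
noncomputable def remainderCoeff (z : Fin k → ℂ) (j : Fin k) (m : ℕ) : ℂ :=
  ((X ^ (k + m) : ℂ[X]) %ₘ rootPoly z).coeff j

/-- Truncation of a family of sequences. -/
def truncate (N : ℕ) (c : Fin k → ℕ → ℂ) (i : Fin k) (m : ℕ) : ℂ := if m < N then c i m else 0

/-- The integrand of the correlation functions in tail coordinates. -/
noncomputable def rootIntegrand (q r : Fin k → ℕ → ℂ) (x : ℕ → ℂ) : ℝ :=
  (∏ i, ‖∑' m, x m * q i m‖ ^ 2) * Real.exp (-∑ j, ‖∑' m, x m * r j m‖ ^ 2)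

theorem rootIntegrand_nonneg (q r : Fin k → ℕ → ℂ) (x : ℕ → ℂ) : 0 ≤ rootIntegrand q r x := by
  unfold rootIntegrand
  positivity

theorem tsum_truncate (c : Fin k → ℕ → ℂ) (i : Fin k) (x : ℕ → ℂ) :
    ∑' m, x m * truncate N c i m = ∑ m : Fin N, x m * c i m := by
  rw [tsum_eq_sum (s := Finset.range N)]
  · rw [Finset.sum_range]
    exact Finset.sum_congr rfl fun m _ => by rw [truncate, if_pos m.2]
  · intro m hm
    rw [truncate, if_neg (by simpa using hm), mul_zero]

theorem measurable_rootIntegrand (q r : Fin k → ℕ → ℂ) : Measurable (rootIntegrand q r) := by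
  have h : ∀ c : ℕ → ℂ, Measurable fun x : ℕ → ℂ => ∑' m, x m * c m := fun c =>
    Measurable.tsum fun m => (measurable_pi_apply m).mul_const _
  unfold rootIntegrand
  refine Measurable.mul (Finset.measurable_fun_prod _ fun i _ => (h _).norm.pow_const 2) ?_
  refine Real.measurable_exp.comp (Measurable.neg ?_)
  exact Finset.measurable_fun_sum _ fun i _ => (h _).norm.pow_const 2

variable {Ω : Type*} [MeasurableSpace Ω] {P : Measure Ω} {G : ℕ → Ω → ℂ}

/-- The integral over `t` becomes an expectation over `G k, G (k + 1), …` on one fixed probability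
space, so `N` enters only through the truncation. -/
theorem lintegral_rootWeight_mul_gaussDensity (hM : M = N + k)
    (hlaw : ∀ i, HasLaw (G i) stdComplexGaussian P) (hindep : iIndepFun G P) (z : Fin k → ℂ) :
    ∫⁻ b : Fin N → ℂ, ENNReal.ofReal (rootWeight z b) *
        ENNReal.ofReal (gaussDensity fun i : Fin M => (rootPoly z * coeffPoly b).coeff i) =
      ENNReal.ofReal (‖(Matrix.vandermonde z).det‖ ^ 2 / Real.pi ^ k) *
        ∫⁻ ω, ENNReal.ofReal (rootIntegrand (truncate N (quotientCoeff z))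
          (truncate N (remainderCoeff z)) fun m => G (k + m) ω) ∂P := by
  let F : (Fin N → ℂ) → ℝ := fun t =>
    (∏ i, ‖∑ m : Fin N, t m * quotientCoeff z i m‖ ^ 2) *
      Real.exp (-∑ j, ‖∑ m : Fin N, t m * remainderCoeff z j m‖ ^ 2)
  have hF : Measurable F := by
    refine Continuous.measurable ?_
    fun_prop
  have hu : Function.Injective fun m : Fin N => k + (m : ℕ) := fun a b h =>
    Fin.ext (Nat.add_left_cancel h)
  have h1 : ∀ ω, rootIntegrand (truncate N (quotientCoeff z))
      (truncate N (remainderCoeff z)) (fun m => G (k + m) ω) = F fun m => G (k + m) ω := by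
    intro ω
    simp only [rootIntegrand, tsum_truncate, F]
  simp_rw [h1]
  rw [lintegral_gaussian hlaw hindep (u := fun m : Fin N => k + (m : ℕ)) hu
    (F := fun t => ENNReal.ofReal (F t)) hF.ennreal_ofReal.aemeasurable,
    ← lintegral_const_mul' _ _ ENNReal.ofReal_ne_top, lintegral_tailQuotient z]
  refine lintegral_congr fun t => ?_
  rw [← ENNReal.ofReal_mul (rootWeight_nonneg _ _), ← ENNReal.ofReal_mul (gaussDensity_nonneg _),
    ← ENNReal.ofReal_mul (by positivity)]
  congr 1
  have h2 : ∀ i, (tailQuotient z t).eval (z i) = ∑ m : Fin N, t m * quotientCoeff z i m := by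
    intro i
    simp [tailQuotient, eval_finsetSum, quotientCoeff]
  have h3 : ∀ j : Fin k, (tailRemainder z t).coeff j = ∑ m : Fin N, t m * remainderCoeff z j m := by
    intro j
    simp [tailRemainder, finsetSum_coeff, remainderCoeff]
  rw [coeffPoly_coeff_eq (tailQuotient_degree_lt z t), gaussDensity_tail hM, rootWeight,
    coeffPoly_coeff_eq (tailQuotient_degree_lt z t)]
  simp only [h2, h3, F]
  ring

end TailCoordinates

/-! ### Absolute moments of the complex Gaussian -/

section Moments

theorem integral_stdComplexGaussian {E : Type*} [NormedAddCommGroup E] [NormedSpace ℝ E]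
    (f : ℂ → E) :
    ∫ z, f z ∂stdComplexGaussian = ∫ z, (Real.exp (-‖z‖ ^ 2) / Real.pi) • f z := by
  rw [stdComplexGaussian, integral_withDensity_eq_integral_toReal_smul measurable_stdDensity
    (Eventually.of_forall fun _ => ENNReal.ofReal_lt_top)]
  refine integral_congr_ae (Eventually.of_forall fun z => ?_)
  simp only
  rw [ENNReal.toReal_ofReal (by positivity)]

theorem integral_norm_pow_stdComplexGaussian (p : ℕ) :
    ∫ z, ‖z‖ ^ p ∂stdComplexGaussian = Real.Gamma ((p + 2) / 2) := by
  have h := Complex.integral_rpow_mul_exp_neg_rpow (p := 2) (q := p) one_le_two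
    (by linarith [(Nat.cast_nonneg p : (0 : ℝ) ≤ p)])
  simp only [Real.rpow_natCast, Real.rpow_two] at h
  rw [integral_stdComplexGaussian]
  have : ∀ z : ℂ, (Real.exp (-‖z‖ ^ 2) / Real.pi) • ‖z‖ ^ p =
      Real.pi⁻¹ * (‖z‖ ^ p * Real.exp (-‖z‖ ^ 2)) := fun z => by
    rw [smul_eq_mul]
    ring
  simp_rw [this]
  rw [integral_const_mul, h]
  field_simp

/-- The integral of a non-integrable function is `0` by convention, but here it is a positive Gamma
value. -/
theorem integrable_norm_pow_stdComplexGaussian (p : ℕ) :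
    Integrable (fun z : ℂ => ‖z‖ ^ p) stdComplexGaussian := by
  by_contra h
  have h1 := integral_norm_pow_stdComplexGaussian p
  rw [integral_undef h] at h1
  exact (Real.Gamma_pos_of_pos (by positivity)).ne h1

theorem integral_norm_sq_pow_stdComplexGaussian (p : ℕ) :
    ∫ z, ‖z‖ ^ (2 * p) ∂stdComplexGaussian = (p.factorial : ℝ) := by
  rw [integral_norm_pow_stdComplexGaussian, ← Real.Gamma_nat_eq_factorial]
  congr 1
  push_cast
  ring

end Moments

/-! ### Dominated convergence of the densities -/

section Convergence

variable {k : ℕ} {Ω : Type*} [MeasurableSpace Ω] {P : Measure Ω} {G : ℕ → Ω → ℂ}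

/-- Weighted sums of powers of Gaussians are integrable. -/
theorem exists_integrable_bound (hlaw : ∀ i, HasLaw (G i) stdComplexGaussian P) (p : ℕ)
    {γ : ℝ} (hγ0 : 0 ≤ γ) (hγ1 : γ < 1) (hp : p ≠ 0) :
    ∃ Z : Ω → ℝ, Integrable Z P ∧ ∀ᵐ ω ∂P, ∀ m, (γ ^ m * ‖G m ω‖) ^ p ≤ Z ω := by
  -- The sum dominates each term, and its expectation is a geometric series of ratio `γ ^ p < 1`.
  let Z : Ω → ℝ≥0∞ := fun ω => ∑' m, ENNReal.ofReal ((γ ^ m * ‖G m ω‖) ^ p)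
  have hm : ∀ m, AEMeasurable (fun ω => ENNReal.ofReal ((γ ^ m * ‖G m ω‖) ^ p)) P := fun m =>
    (((hlaw m).aemeasurable.norm.const_mul _).pow_const _).ennreal_ofReal
  have hZm : AEMeasurable Z P := AEMeasurable.tsum hm
  have hint : ∀ m, ∫⁻ ω, ENNReal.ofReal ((γ ^ m * ‖G m ω‖) ^ p) ∂P =
      ENNReal.ofReal ((γ ^ p) ^ m * Real.Gamma ((p + 2) / 2)) := by
    intro m
    have hF : Measurable fun z : ℂ => ENNReal.ofReal ((γ ^ m * ‖z‖) ^ p) := by fun_prop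
    have h1 := lintegral_map' (f := fun z : ℂ => ENNReal.ofReal ((γ ^ m * ‖z‖) ^ p))
      hF.aemeasurable (hlaw m).aemeasurable
    rw [← h1, (hlaw m).map_eq, ← integral_norm_pow_stdComplexGaussian, ← integral_const_mul,
      ofReal_integral_eq_lintegral_ofReal]
    · refine lintegral_congr fun z => ?_
      rw [mul_pow, ← pow_mul, ← pow_mul, mul_comm m p]
    · exact (integrable_norm_pow_stdComplexGaussian p).const_mul _
    · exact Eventually.of_forall fun z => by positivity
  have hfin : ∫⁻ ω, Z ω ∂P ≠ ∞ := by
    rw [lintegral_tsum hm]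
    simp_rw [hint]
    refine Summable.tsum_ofReal_ne_top ?_
    refine (summable_geometric_of_lt_one (by positivity) ?_).mul_right _
    exact pow_lt_one₀ hγ0 hγ1 hp
  refine ⟨fun ω => (Z ω).toReal, integrable_toReal_of_lintegral_ne_top hZm hfin, ?_⟩
  filter_upwards [ae_lt_top' hZm hfin] with ω hω m
  rw [← ENNReal.ofReal_le_iff_le_toReal hω.ne]
  exact ENNReal.le_tsum m

/-- Of the decay `γ ^ m * γ ^ m`, one factor absorbs the growth of `G m`, so that `γ ^ m * ‖G m‖ ≤
R`, and the other makes the series converge. Each linear form is then at most `C R / (1 - γ)` and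
the exponential at most `1`. The filter is general to cover both continuity in `z` and the joint
limit in `(N, z)`. -/
theorem tendsto_integral_rootIntegrand [IsProbabilityMeasure P]
    (hlaw : ∀ i, HasLaw (G i) stdComplexGaussian P)
    {ι : Type*} {l : Filter ι} [l.IsCountablyGenerated] {q r : ι → Fin k → ℕ → ℂ}
    {q₀ r₀ : Fin k → ℕ → ℂ} {C γ : ℝ} (hC : 0 ≤ C) (hγ0 : 0 ≤ γ) (hγ1 : γ < 1)
    (hq : ∀ᶠ t in l, ∀ i m, ‖q t i m‖ ≤ C * (γ ^ m * γ ^ m))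
    (hr : ∀ᶠ t in l, ∀ i m, ‖r t i m‖ ≤ C * (γ ^ m * γ ^ m))
    (hq₀ : ∀ i m, Tendsto (fun t => q t i m) l (𝓝 (q₀ i m)))
    (hr₀ : ∀ i m, Tendsto (fun t => r t i m) l (𝓝 (r₀ i m))) :
    Tendsto (fun t => ∫ ω, rootIntegrand (q t) (r t) (fun m => G m ω) ∂P) l
      (𝓝 (∫ ω, rootIntegrand q₀ r₀ (fun m => G m ω) ∂P)) := by
  -- The power `R ^ (2 * k)` must be integrable. The exponent `2 * k + 1` stays nonzero for `k = 0`;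
  -- with `R` the corresponding root of `Z`, `R ^ (2 * k) ≤ 1 + Z`.
  obtain ⟨Z, hZ, hZG⟩ := exists_integrable_bound hlaw (2 * k + 1) hγ0 hγ1 (by omega)
  have hX : AEMeasurable (fun ω m => G m ω) P :=
    aemeasurable_pi_lambda _ fun m => (hlaw m).aemeasurable
  have hmeas : ∀ q r : Fin k → ℕ → ℂ,
      AEStronglyMeasurable (fun ω => rootIntegrand q r (fun m => G m ω)) P := fun q r =>
    ((measurable_rootIntegrand q r).comp_aemeasurable hX).aestronglyMeasurable
  have hgs : Summable fun m => γ ^ m := summable_geometric_of_lt_one hγ0 hγ1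
  have hbd : ∀ᵐ ω ∂P, ∃ R : ℝ, 0 ≤ R ∧ R ^ (2 * k) ≤ 1 + Z ω ∧ ∀ m, γ ^ m * ‖G m ω‖ ≤ R := by
    filter_upwards [hZG] with ω hω
    have hZ0 : 0 ≤ Z ω := le_trans (by positivity) (hω 0)
    have hR : ((Z ω) ^ ((((2 * k + 1 : ℕ) : ℝ))⁻¹)) ^ (2 * k + 1) = Z ω :=
      Real.rpow_inv_natCast_pow hZ0 (by omega)
    set R := (Z ω) ^ ((((2 * k + 1 : ℕ) : ℝ))⁻¹)
    have hR0 : 0 ≤ R := Real.rpow_nonneg hZ0 _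
    refine ⟨R, hR0, ?_, fun m => ?_⟩
    · rcases le_total R 1 with h | h
      · exact (pow_le_one₀ hR0 h).trans (by linarith)
      · have := pow_le_pow_right₀ h (Nat.le_succ (2 * k))
        rw [Nat.succ_eq_add_one, hR] at this
        linarith
    · refine le_of_pow_le_pow_left₀ (n := 2 * k + 1) (by omega) hR0 ?_
      rw [hR]
      exact hω m
  have hterm : ∀ (c : Fin k → ℕ → ℂ), (∀ i m, ‖c i m‖ ≤ C * (γ ^ m * γ ^ m)) →
      ∀ (x : ℕ → ℂ) (R : ℝ), (∀ m, γ ^ m * ‖x m‖ ≤ R) → ∀ i m, ‖x m * c i m‖ ≤ C * R * γ ^ m := by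
    intro c hc x R hx i m
    rw [norm_mul]
    calc ‖x m‖ * ‖c i m‖ ≤ ‖x m‖ * (C * (γ ^ m * γ ^ m)) := by gcongr; exact hc i m
      _ = C * γ ^ m * (γ ^ m * ‖x m‖) := by ring
      _ ≤ C * γ ^ m * R := by gcongr; exact hx m
      _ = _ := by ring
  refine tendsto_integral_filter_of_dominated_convergence
    (fun ω => (C / (1 - γ)) ^ (2 * k) * (1 + Z ω)) (Eventually.of_forall fun t => hmeas _ _) ?_
    (((integrable_const 1).add hZ).const_mul _) ?_
  · filter_upwards [hq] with t hqt
    filter_upwards [hbd] with ω ⟨R, hR0, hRZ, hRG⟩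
    rw [Real.norm_of_nonneg (rootIntegrand_nonneg _ _ _), rootIntegrand]
    have h1 : ∀ i, ‖∑' m, G m ω * q t i m‖ ≤ C / (1 - γ) * R := by
      intro i
      have h2 := tsum_of_norm_bounded (hgs.mul_left (C * R)).hasSum
        (hterm (q t) hqt (fun m => G m ω) R hRG i)
      rw [tsum_mul_left, tsum_geometric_of_lt_one hγ0 hγ1] at h2
      refine h2.trans (le_of_eq ?_)
      rw [div_eq_mul_inv]
      ring
    have h3 : Real.exp (-∑ j, ‖∑' m, G m ω * r t j m‖ ^ 2) ≤ 1 := by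
      rw [Real.exp_le_one_iff, neg_nonpos]
      positivity
    calc _ ≤ (∏ i : Fin k, ‖∑' m, G m ω * q t i m‖ ^ 2) * 1 := by gcongr
      _ ≤ ∏ i : Fin k, (C / (1 - γ) * R) ^ 2 := by
          rw [mul_one]
          exact Finset.prod_le_prod (fun _ _ => by positivity) fun i _ => by gcongr; exact h1 i
      _ = (C / (1 - γ)) ^ (2 * k) * R ^ (2 * k) := by
          rw [Finset.prod_const, Finset.card_univ, Fintype.card_fin, ← pow_mul, mul_pow]
      _ ≤ _ := by
          have : 0 ≤ C / (1 - γ) := div_nonneg hC (by linarith)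
          gcongr
  · filter_upwards [hbd] with ω ⟨R, hR0, hRZ, hRG⟩
    have hsum : ∀ {c : ι → Fin k → ℕ → ℂ} {c₀ : Fin k → ℕ → ℂ},
        (∀ᶠ t in l, ∀ i m, ‖c t i m‖ ≤ C * (γ ^ m * γ ^ m)) →
        (∀ i m, Tendsto (fun t => c t i m) l (𝓝 (c₀ i m))) → ∀ i,
        Tendsto (fun t => ∑' m, G m ω * c t i m) l (𝓝 (∑' m, G m ω * c₀ i m)) := by
      intro c c₀ hc hc₀ i
      refine tendsto_tsum_of_dominated_convergence (hgs.mul_left (C * R))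
        (fun m => (hc₀ i m).const_mul _) ?_
      filter_upwards [hc] with t ht m
      exact hterm (c t) ht (fun m => G m ω) R hRG i m
    unfold rootIntegrand
    refine Tendsto.mul (tendsto_finsetProd _ fun i _ => ((hsum hq hq₀ i).norm.pow 2)) ?_
    refine (Real.continuous_exp.tendsto _).comp (Tendsto.neg ?_)
    exact tendsto_finsetSum _ fun i _ => (hsum hr hr₀ i).norm.pow 2

theorem continuous_quotientCoeff (i : Fin k) (m : ℕ) :
    Continuous fun z : Fin k → ℂ => quotientCoeff z i m :=
  continuous_quotient_eval (k + m) i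

theorem continuous_remainderCoeff (i : Fin k) (m : ℕ) :
    Continuous fun z : Fin k → ℂ => remainderCoeff z i m :=
  continuous_remainder_coeff (k + m) i

/-- The continuous version of the `k`-point correlation function of the Kac polynomial of
degree `n = N + k - 1`. -/
noncomputable def corrDensity (P : Measure Ω) (G : ℕ → Ω → ℂ) (N : ℕ) (z : Fin k → ℂ) : ℝ :=
  ‖(Matrix.vandermonde z).det‖ ^ 2 / Real.pi ^ k *
    ∫ ω, rootIntegrand (truncate N (quotientCoeff z)) (truncate N (remainderCoeff z))
      (fun m => G (k + m) ω) ∂P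

/-- The limit of `corrDensity` on the unit polydisc. -/
noncomputable def corrDensityLimit (P : Measure Ω) (G : ℕ → Ω → ℂ) (z : Fin k → ℂ) : ℝ :=
  ‖(Matrix.vandermonde z).det‖ ^ 2 / Real.pi ^ k *
    ∫ ω, rootIntegrand (quotientCoeff z) (remainderCoeff z) (fun m => G (k + m) ω) ∂P

theorem corrDensity_nonneg (N : ℕ) (z : Fin k → ℂ) : 0 ≤ corrDensity P G N z :=
  mul_nonneg (by positivity) (integral_nonneg fun _ => rootIntegrand_nonneg _ _ _)

theorem norm_truncate_le (N : ℕ) (c : Fin k → ℕ → ℂ) (i : Fin k) (m : ℕ) :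
    ‖truncate N c i m‖ ≤ ‖c i m‖ := by
  unfold truncate
  split_ifs <;> simp

theorem continuous_corrDensity [IsProbabilityMeasure P]
    (hlaw : ∀ i, HasLaw (G i) stdComplexGaussian P) (N : ℕ) :
    Continuous (corrDensity (k := k) P G N) := by
  unfold corrDensity
  refine ((continuous_det_vandermonde.norm.pow 2).div_const _).mul ?_
  rw [continuous_iff_continuousAt]
  intro z₀
  have hloc : ∀ c : (Fin k → ℂ) → Fin k → ℕ → ℂ, (∀ i m, Continuous fun z => c z i m) →
      ∃ B, 0 ≤ B ∧ ∀ᶠ z in 𝓝 z₀, ∀ i m, ‖truncate N (c z) i m‖ ≤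
        B * ((1 / 2) ^ m * (1 / 2) ^ m) := by
    intro c hc
    let B₀ := ∑ i, ∑ m ∈ Finset.range N, (‖c z₀ i m‖ + 1)
    have hB : ∀ i, ∀ m < N, ‖c z₀ i m‖ + 1 ≤ B₀ := fun i m hm =>
      (Finset.single_le_sum (f := fun m => ‖c z₀ i m‖ + 1) (fun _ _ => by positivity)
        (Finset.mem_range.2 hm)).trans
      (Finset.single_le_sum (f := fun i => ∑ m ∈ Finset.range N, (‖c z₀ i m‖ + 1))
        (fun _ _ => by positivity) (Finset.mem_univ i))
    have hev : ∀ᶠ z in 𝓝 z₀, ∀ i, ∀ m ∈ Finset.range N, ‖c z i m‖ < ‖c z₀ i m‖ + 1 := by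
      rw [eventually_all]
      intro i
      rw [Finset.eventually_all]
      intro m _
      exact (hc i m).norm.continuousAt.eventually_lt continuousAt_const (by linarith)
    have hB0 : 0 ≤ B₀ := by positivity
    -- Only indices `m < N` survive truncation, and there `2 ^ N * (1 / 2) ^ m ≥ 1`; so a local
    -- bound `B₀` becomes a geometric one.
    refine ⟨B₀ * (2 ^ N * 2 ^ N), by positivity, ?_⟩
    filter_upwards [hev] with z hz i m
    unfold truncate
    split_ifs with hm
    · refine ((hz i m (Finset.mem_range.2 hm)).le.trans (hB i m hm)).trans ?_
      rw [mul_assoc]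
      refine le_mul_of_one_le_right hB0 ?_
      have h1 : (1 : ℝ) ≤ 2 ^ N * (1 / 2) ^ m := by
        rw [one_div, inv_pow, ← div_eq_mul_inv, one_le_div (by positivity)]
        exact pow_le_pow_right₀ one_le_two hm.le
      calc (1 : ℝ) ≤ (2 ^ N * (1 / 2) ^ m) * (2 ^ N * (1 / 2) ^ m) :=
            one_le_mul_of_one_le_of_one_le h1 h1
        _ = _ := by ring
    · rw [norm_zero]
      positivity
  obtain ⟨B, hB0, hB⟩ := hloc _ continuous_quotientCoeff
  obtain ⟨B', hB0', hB'⟩ := hloc _ continuous_remainderCoeff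
  have htr : ∀ c : (Fin k → ℂ) → Fin k → ℕ → ℂ, (∀ i m, Continuous fun z => c z i m) → ∀ i m,
      Tendsto (fun z => truncate N (c z) i m) (𝓝 z₀) (𝓝 (truncate N (c z₀) i m)) := by
    intro c hc i m
    unfold truncate
    split_ifs
    · exact (hc i m).tendsto z₀
    · exact tendsto_const_nhds
  refine tendsto_integral_rootIntegrand (G := fun m => G (k + m)) (fun m => hlaw (k + m))
    (C := max B B') (γ := 1 / 2) (le_max_of_le_left hB0)
    (by norm_num) (by norm_num) ?_ ?_ (htr _ continuous_quotientCoeff)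
    (htr _ continuous_remainderCoeff)
  · filter_upwards [hB] with z hz i m
    exact (hz i m).trans (mul_le_mul_of_nonneg_right (le_max_left _ _) (by positivity))
  · filter_upwards [hB'] with z hz i m
    exact (hz i m).trans (mul_le_mul_of_nonneg_right (le_max_right _ _) (by positivity))

/-- Continuous convergence of `corrDensity` on the open unit polydisc. -/
theorem tendsto_corrDensity [IsProbabilityMeasure P]
    (hlaw : ∀ i, HasLaw (G i) stdComplexGaussian P) {z₀ : Fin k → ℂ} (hz₀ : ∀ i, ‖z₀ i‖ < 1) :
    Tendsto (fun p : ℕ × (Fin k → ℂ) => corrDensity P G p.1 p.2) (atTop ×ˢ 𝓝 z₀)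
      (𝓝 (corrDensityLimit P G z₀)) := by
  have hy : ∃ y : ℝ, 0 < y ∧ y < 1 ∧ ∀ i, ‖z₀ i‖ < y := by
    have h1 : ‖z₀‖ < 1 := (pi_norm_lt_iff one_pos).2 hz₀
    obtain ⟨y, hy1, hy2⟩ := exists_between h1
    exact ⟨y, (norm_nonneg _).trans_lt hy1, hy2, fun i => (norm_le_pi_norm z₀ i).trans_lt hy1⟩
  obtain ⟨y, hy0, hy1, hy⟩ := hy
  obtain ⟨θ, hθy, hθ1⟩ := exists_between hy1
  have hθ0 : 0 < θ := hy0.trans hθy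
  obtain ⟨K, hK, hb⟩ := exists_div_mod_X_pow_le k hθy hθ0 hθ1.le
  -- The rate `γ` is `√θ`, which splits `θ ^ m` into the two required factors.
  have hsq : ∀ m, Real.sqrt θ ^ m * Real.sqrt θ ^ m = θ ^ m := fun m => by
    rw [← mul_pow, Real.mul_self_sqrt hθ0.le]
  have hK' : ∀ m, K * θ ^ (k + m) ≤ K * (Real.sqrt θ ^ m * Real.sqrt θ ^ m) := fun m => by
    rw [hsq]
    gcongr K * ?_
    exact pow_le_pow_of_le_one hθ0.le hθ1.le (by omega)
  have hev : ∀ᶠ p : ℕ × (Fin k → ℂ) in atTop ×ˢ 𝓝 z₀, ∀ i, ‖p.2 i‖ ≤ y := by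
    have : ∀ᶠ z in 𝓝 z₀, ∀ i, ‖z i‖ ≤ y := by
      rw [eventually_all]
      intro i
      have hc : Continuous fun z : Fin k → ℂ => ‖z i‖ := (continuous_apply i).norm
      exact (hc.continuousAt.eventually_lt continuousAt_const (hy i)).mono fun z hz => hz.le
    exact tendsto_snd.eventually this
  have htr : ∀ c : (Fin k → ℂ) → Fin k → ℕ → ℂ, (∀ i m, Continuous fun z => c z i m) → ∀ i m,
      Tendsto (fun p : ℕ × (Fin k → ℂ) => truncate p.1 (c p.2) i m) (atTop ×ˢ 𝓝 z₀)
        (𝓝 (c z₀ i m)) := by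
    intro c hc i m
    have h1 : Tendsto (fun p : ℕ × (Fin k → ℂ) => c p.2 i m) (atTop ×ˢ 𝓝 z₀) (𝓝 (c z₀ i m)) :=
      ((hc i m).tendsto z₀).comp tendsto_snd
    refine h1.congr' ?_
    filter_upwards [tendsto_fst.eventually (eventually_gt_atTop m)] with p hp
    rw [truncate, if_pos hp]
  unfold corrDensity corrDensityLimit
  refine Tendsto.mul ?_ ?_
  · exact (((continuous_det_vandermonde.norm.pow 2).div_const _).tendsto z₀).comp tendsto_snd
  · refine tendsto_integral_rootIntegrand (G := fun m => G (k + m)) (fun m => hlaw (k + m))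
      (C := K) (γ := Real.sqrt θ) hK (Real.sqrt_nonneg _)
      (by rw [Real.sqrt_lt' one_pos]; simpa using hθ1) ?_ ?_ (htr _ continuous_quotientCoeff)
      (htr _ continuous_remainderCoeff)
    · filter_upwards [hev] with p hp i m
      exact ((norm_truncate_le _ _ _ _).trans ((hb p.2 hp (k + m)).1 i)).trans (hK' m)
    · filter_upwards [hev] with p hp i m
      exact ((norm_truncate_le _ _ _ _).trans ((hb p.2 hp (k + m)).2 i)).trans (hK' m)

end Convergence

/-! ### Wick's formula for complex Gaussians -/

section Wick

variable {κ ι : Type*} [Fintype κ] [Fintype ι]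

theorem lintegral_stdDensity :
    ∫⁻ z : ℂ, ENNReal.ofReal (Real.exp (-‖z‖ ^ 2) / Real.pi) = 1 := by
  have h1 : ∫ _ : ℂ, (1 : ℝ) ∂stdComplexGaussian = 1 := by
    simpa using integral_norm_sq_pow_stdComplexGaussian 0
  have h2 : Integrable (fun _ : ℂ => (1 : ℝ)) stdComplexGaussian := by
    simpa using integrable_norm_pow_stdComplexGaussian 0
  have h3 := ofReal_integral_eq_lintegral_ofReal h2 (Eventually.of_forall fun _ => zero_le_one)
  rw [h1] at h3
  simp only [ENNReal.ofReal_one, lintegral_const, one_mul] at h3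
  rw [h3, stdComplexGaussian, withDensity_apply _ MeasurableSet.univ, Measure.restrict_univ]

theorem integrable_pow_mul_conj_pow (p q : ℕ) :
    Integrable (fun z : ℂ => z ^ p * conj z ^ q) stdComplexGaussian := by
  refine (integrable_norm_pow_stdComplexGaussian (p + q)).mono'
    (by fun_prop) (Eventually.of_forall fun z => ?_)
  simp [pow_add]

theorem integral_pow_mul_conj_pow (p q : ℕ) :
    ∫ z, z ^ p * conj z ^ q ∂stdComplexGaussian = if p = q then (p.factorial : ℂ) else 0 := by
  split_ifs with h
  · subst h
    have : ∀ z : ℂ, z ^ p * conj z ^ p = ((‖z‖ ^ (2 * p) : ℝ) : ℂ) := fun z => by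
      rw [← mul_pow, Complex.mul_conj, Complex.normSq_eq_norm_sq, pow_mul]
      push_cast
      rfl
    simp_rw [this]
    rw [integral_complex_ofReal, integral_norm_sq_pow_stdComplexGaussian]
    simp
  · have hpq : ((p : ℝ) - q) ≠ 0 := sub_ne_zero.2 (by exact_mod_cast h)
    -- Rotation by this angle preserves the Gaussian law and multiplies `z ^ p * conj z ^ q` by
    -- `-1`, so the integral equals its own negative.
    let t : ℝ := Real.pi / (p - q)
    let c : Circle := Circle.exp t
    have hc : (c : ℂ) ^ p * conj (c : ℂ) ^ q = -1 := by
      have h1 : (c : ℂ) = Complex.exp (t * Complex.I) := Circle.coe_exp t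
      rw [h1, ← Complex.exp_conj, ← Complex.exp_nat_mul, ← Complex.exp_nat_mul, ← Complex.exp_add,
        ← Complex.exp_pi_mul_I]
      congr 1
      simp only [map_mul, Complex.conj_ofReal, Complex.conj_I]
      have h2 : ((p : ℂ) - q) * t = Real.pi := by
        have : ((p : ℝ) - q) * t = Real.pi := mul_div_cancel₀ _ hpq
        exact_mod_cast this
      linear_combination Complex.I * h2
    have hrot := (rotation c).measurePreserving.integral_comp
      (rotation c).toHomeomorph.measurableEmbedding
      (fun z => (Real.exp (-‖z‖ ^ 2) / Real.pi) • (z ^ p * conj z ^ q))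
    rw [integral_stdComplexGaussian]
    have h3 : ∀ z : ℂ, (Real.exp (-‖rotation c z‖ ^ 2) / Real.pi) •
        (rotation c z ^ p * conj (rotation c z) ^ q) =
        -((Real.exp (-‖z‖ ^ 2) / Real.pi) • (z ^ p * conj z ^ q)) := by
      intro z
      rw [LinearIsometryEquiv.norm_map, rotation_apply, map_mul, mul_pow, mul_pow, ← smul_neg]
      congr 1
      linear_combination (z ^ p * conj z ^ q) * hc
    simp_rw [h3] at hrot
    rw [integral_neg] at hrot
    exact self_eq_neg.1 hrot.symm

/-- If the fibres of `f` and `g` have equal sizes, the permutations taking `f` to `g` form a coset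
of the stabilizer of `f`, of order the product of the factorials of the fibre sizes; otherwise there
are none. This is the product of the one-variable moments. -/
theorem card_perm_comp_eq [DecidableEq κ] [DecidableEq ι] (f g : κ → ι) :
    (Fintype.card {σ : Equiv.Perm κ // f ∘ σ = g}) =
      ∏ l, if Fintype.card {i // f i = l} = Fintype.card {i // g i = l}
        then (Fintype.card {i // f i = l}).factorial else 0 := by
  by_cases h : ∀ l, Fintype.card {i // f i = l} = Fintype.card {i // g i = l}
  · simp only [h, if_true]
    let σ₀ : Equiv.Perm κ := Equiv.ofFiberEquiv fun l => Fintype.equivOfCardEq (h l).symm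
    have hσ : f ∘ σ₀ = g := funext fun i => Equiv.ofFiberEquiv_map _ i
    have e : {σ : Equiv.Perm κ // f ∘ σ = g} ≃ {τ : Equiv.Perm κ // f ∘ τ = f} :=
      { toFun := fun σ => ⟨σ₀.symm.trans σ.1, by
          have := σ.2
          funext i
          have h1 := congrFun this (σ₀.symm i)
          have h2 := congrFun hσ (σ₀.symm i)
          simp only [Function.comp_apply, Equiv.apply_symm_apply] at h1 h2
          simp [h1, h2]⟩
        invFun := fun τ => ⟨σ₀.trans τ.1, by
          have := τ.2
          funext i
          have h1 := congrFun this (σ₀ i)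
          have h2 := congrFun hσ i
          simp only [Function.comp_apply] at h1 h2
          simp [h1, h2]⟩
        left_inv := fun σ => by ext; simp
        right_inv := fun τ => by ext; simp }
    rw [Fintype.card_congr e, DomMulAct.stabilizer_card]
    simp only [h]
  · push Not at h
    obtain ⟨l, hl⟩ := h
    rw [Finset.prod_eq_zero (Finset.mem_univ l) (if_neg hl), Fintype.card_eq_zero_iff]
    refine ⟨fun ⟨σ, hσ⟩ => hl ?_⟩
    refine (Fintype.card_congr ?_).symm
    exact σ.subtypeEquiv fun i => by rw [← hσ]; rfl

theorem prod_comp_eq_prod_pow [DecidableEq ι] (f : κ → ι) (a : ι → ℂ) :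
    ∏ i, a (f i) = ∏ l, a l ^ Fintype.card {i // f i = l} := by
  rw [← Fintype.prod_fiberwise' f a]
  simp

theorem integrable_monomial [DecidableEq ι] (f g : κ → ι) :
    Integrable (fun a : ι → ℂ => (∏ i, a (f i)) * ∏ i, conj (a (g i)))
      (Measure.pi fun _ => stdComplexGaussian) := by
  have h : ∀ a : ι → ℂ, (∏ i, a (f i)) * ∏ i, conj (a (g i)) =
      ∏ l, (a l ^ Fintype.card {i // f i = l} * conj (a l) ^ Fintype.card {i // g i = l}) := by
    intro a
    rw [Finset.prod_mul_distrib, prod_comp_eq_prod_pow f a,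
      prod_comp_eq_prod_pow g fun l => conj (a l)]
  simp_rw [h]
  exact Integrable.fintype_prod fun l => integrable_pow_mul_conj_pow _ _

theorem integral_monomial [DecidableEq κ] [DecidableEq ι] (f g : κ → ι) :
    ∫ a : ι → ℂ, (∏ i, a (f i)) * ∏ i, conj (a (g i)) ∂(Measure.pi fun _ => stdComplexGaussian) =
      (Fintype.card {σ : Equiv.Perm κ // f ∘ σ = g} : ℂ) := by
  have h : ∀ a : ι → ℂ, (∏ i, a (f i)) * ∏ i, conj (a (g i)) =
      ∏ l, (a l ^ Fintype.card {i // f i = l} * conj (a l) ^ Fintype.card {i // g i = l}) := by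
    intro a
    rw [Finset.prod_mul_distrib, prod_comp_eq_prod_pow f a,
      prod_comp_eq_prod_pow g fun l => conj (a l)]
  simp_rw [h]
  rw [integral_fintype_prod_eq_prod (f := fun l z => z ^ Fintype.card {i // f i = l} *
    conj z ^ Fintype.card {i // g i = l}), card_perm_comp_eq]
  simp_rw [integral_pow_mul_conj_pow]
  push_cast
  rfl

theorem prod_mulVec_mul_conj [DecidableEq κ] (L : Matrix κ ι ℂ) (a : ι → ℂ) :
    ∏ i, (L.mulVec a i * conj (L.mulVec a i)) =
      ∑ f : κ → ι, ∑ g : κ → ι, ((∏ i, L i (f i)) * ∏ i, conj (L i (g i))) *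
        ((∏ i, a (f i)) * ∏ i, conj (a (g i))) := by
  rw [Finset.prod_mul_distrib, ← map_prod]
  have h : ∏ i, L.mulVec a i = ∑ f : κ → ι, (∏ i, L i (f i)) * ∏ i, a (f i) := by
    simp only [Matrix.mulVec, dotProduct]
    rw [Finset.prod_univ_sum, Fintype.piFinset_univ]
    simp only [Finset.prod_mul_distrib]
  rw [h, map_sum, Finset.sum_mul_sum]
  refine Finset.sum_congr rfl fun f _ => Finset.sum_congr rfl fun g _ => ?_
  simp only [map_mul, map_prod]
  ring

/-- Expanding the entries chooses a column `f i` for each row. The permutation in the permanent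
turns the conjugate factor into the one indexed by `g = f ∘ σ`, so grouping by `g` counts
permutations. -/
theorem permanent_mul_conjTranspose [DecidableEq κ] [DecidableEq ι] (L : Matrix κ ι ℂ) :
    (L * L.conjTranspose).permanent = ∑ f : κ → ι, ∑ g : κ → ι,
      ((∏ i, L i (f i)) * ∏ i, conj (L i (g i))) *
        (Fintype.card {σ : Equiv.Perm κ // f ∘ σ = g} : ℂ) := by
  have h1 : ∀ f g : κ → ι, (Fintype.card {σ : Equiv.Perm κ // f ∘ σ = g} : ℂ) =
      ∑ σ : Equiv.Perm κ, if f ∘ σ = g then 1 else 0 := by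
    intro f g
    rw [Fintype.card_subtype, Finset.sum_boole]
  simp_rw [h1, Finset.mul_sum]
  have h2 : ∀ f : κ → ι, (∑ g : κ → ι, ∑ σ : Equiv.Perm κ,
      ((∏ i, L i (f i)) * ∏ i, conj (L i (g i))) * (if f ∘ σ = g then 1 else 0)) =
      ∑ σ : Equiv.Perm κ, (∏ i, L i (f i)) * ∏ i, conj (L i (f (σ i))) := by
    intro f
    rw [Finset.sum_comm]
    refine Finset.sum_congr rfl fun σ _ => ?_
    simp
  simp_rw [h2]
  rw [Finset.sum_comm, Matrix.permanent]
  refine Finset.sum_congr rfl fun σ _ => ?_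
  have h3 := Equiv.prod_comp σ fun j => (L * L.conjTranspose) j (σ.symm j)
  simp only [Equiv.symm_apply_apply] at h3
  rw [h3]
  simp only [Matrix.mul_apply, Matrix.conjTranspose_apply]
  rw [Finset.prod_univ_sum, Fintype.piFinset_univ]
  refine Finset.sum_congr rfl fun f _ => ?_
  rw [Finset.prod_mul_distrib]
  have h4 := Equiv.prod_comp σ fun j => conj (L (σ.symm j) (f j))
  simp only [Equiv.symm_apply_apply] at h4
  rw [h4]
  rfl

/-- Wick's formula. -/
theorem integral_prod_mulVec [DecidableEq κ] [DecidableEq ι] (L : Matrix κ ι ℂ) :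
    ∫ a : ι → ℂ, ∏ i, (L.mulVec a i * conj (L.mulVec a i))
      ∂(Measure.pi fun _ => stdComplexGaussian) = (L * L.conjTranspose).permanent := by
  simp_rw [prod_mulVec_mul_conj]
  rw [integral_finsetSum _ fun f _ => integrable_finsetSum _ fun g _ =>
    (integrable_monomial f g).const_mul _, permanent_mul_conjTranspose]
  refine Finset.sum_congr rfl fun f _ => ?_
  rw [integral_finsetSum _ fun g _ => (integrable_monomial f g).const_mul _]
  refine Finset.sum_congr rfl fun g _ => ?_
  rw [integral_const_mul, integral_monomial]

theorem integrable_prod_mulVec [DecidableEq κ] [DecidableEq ι] (L : Matrix κ ι ℂ) :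
    Integrable (fun a : ι → ℂ => ∏ i, (L.mulVec a i * conj (L.mulVec a i)))
      (Measure.pi fun _ => stdComplexGaussian) := by
  simp_rw [prod_mulVec_mul_conj]
  exact integrable_finsetSum _ fun f _ => integrable_finsetSum _ fun g _ =>
    (integrable_monomial f g).const_mul _

end Wick

/-! ### Splitting coordinates into two blocks -/

section SumCoordinates

variable {N k : ℕ}

theorem lintegral_sum_elim {f : (Fin k ⊕ Fin N → ℂ) → ℝ≥0∞} (hf : Measurable f) :
    ∫⁻ x, f x = ∫⁻ u : Fin k → ℂ, ∫⁻ b : Fin N → ℂ, f (Sum.elim u b) := by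
  have h := (volume_measurePreserving_sumPiEquivProdPi_symm
    (fun _ : Fin k ⊕ Fin N => ℂ)).lintegral_comp hf
  rw [← h, Measure.volume_eq_prod, lintegral_prod]
  · refine lintegral_congr fun u => lintegral_congr fun b => congrArg f ?_
    ext (i | i) <;> rfl
  · exact (hf.comp (MeasurableEquiv.measurable _)).aemeasurable

theorem lintegral_comp_finSumFinEquiv {f : (Fin (k + N) → ℂ) → ℝ≥0∞} (hf : Measurable f) :
    ∫⁻ a, f a = ∫⁻ x : Fin k ⊕ Fin N → ℂ, f (x ∘ finSumFinEquiv.symm) := by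
  have h := (volume_preserving_arrowCongr' (α₁ := Fin k ⊕ Fin N) (β₁ := ℂ) finSumFinEquiv
    (MeasurableEquiv.refl ℂ) (MeasurePreserving.id volume)).lintegral_comp hf
  rw [← h]
  rfl

end SumCoordinates

/-! ### Hermitian norms and Gram matrices -/

section VectorNorms

variable {κ ι : Type*} [Fintype κ] [Fintype ι]

theorem sum_norm_sq_add {x y : ι → ℂ} (h : star x ⬝ᵥ y = 0) :
    ∑ i, ‖(x + y) i‖ ^ 2 = ∑ i, ‖x i‖ ^ 2 + ∑ i, ‖y i‖ ^ 2 := by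
  have h1 : ∀ i, ‖(x + y) i‖ ^ 2 = ‖x i‖ ^ 2 + ‖y i‖ ^ 2 + 2 * (star (x i) * y i).re := by
    intro i
    rw [Pi.add_apply, ← Complex.normSq_eq_norm_sq, ← Complex.normSq_eq_norm_sq,
      ← Complex.normSq_eq_norm_sq, Complex.normSq_add]
    simp
  have h2 : ∑ i, (star (x i) * y i).re = 0 := by
    rw [← Complex.re_sum]
    exact congrArg Complex.re h
  simp_rw [h1]
  rw [Finset.sum_add_distrib, Finset.sum_add_distrib, ← Finset.mul_sum, h2]
  ring

theorem sum_norm_sq_mulVec (X : Matrix ι κ ℂ) (u : κ → ℂ) :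
    ((∑ i, ‖X.mulVec u i‖ ^ 2 : ℝ) : ℂ) = star u ⬝ᵥ (X.conjTranspose * X).mulVec u := by
  rw [← Matrix.mulVec_mulVec, Matrix.dotProduct_mulVec, Matrix.vecMul_conjTranspose, star_star,
    dotProduct]
  push_cast
  refine Finset.sum_congr rfl fun i _ => ?_
  rw [Pi.star_apply, Complex.star_def, mul_comm, Complex.mul_conj, Complex.normSq_eq_norm_sq]
  push_cast
  rfl

theorem sum_norm_sq_mulVec_congr {ι' : Type*} [Fintype ι'] {X : Matrix ι κ ℂ} {Y : Matrix ι' κ ℂ}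
    (h : X.conjTranspose * X = Y.conjTranspose * Y) (u : κ → ℂ) :
    ∑ i, ‖X.mulVec u i‖ ^ 2 = ∑ i, ‖Y.mulVec u i‖ ^ 2 := by
  have h1 := sum_norm_sq_mulVec X u
  rw [h, ← sum_norm_sq_mulVec] at h1
  exact_mod_cast h1

end VectorNorms

/-! ### Evaluation, derivatives and sections of evaluation -/

section EvaluationMatrices

open Polynomial
open scoped ComplexOrder

variable {N k M : ℕ}

/-- Evaluation of polynomials of degree less than `M` at the points `z i`. -/
noncomputable def evalMatrix (M : ℕ) (z : Fin k → ℂ) : Matrix (Fin k) (Fin M) ℂ :=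
  Matrix.of fun i m => z i ^ (m : ℕ)

/-- Evaluation of derivatives of polynomials of degree less than `M` at the points `z i`. -/
noncomputable def derivMatrix (M : ℕ) (z : Fin k → ℂ) : Matrix (Fin k) (Fin M) ℂ :=
  Matrix.of fun i m => m * z i ^ ((m : ℕ) - 1)

theorem evalMatrix_mulVec (z : Fin k → ℂ) (a : Fin M → ℂ) (i : Fin k) :
    (evalMatrix M z).mulVec a i = (coeffPoly a).eval (z i) := by
  simp only [coeffPoly_eval, Matrix.mulVec, dotProduct, evalMatrix, Matrix.of_apply, mul_comm]

theorem derivMatrix_mulVec (z : Fin k → ℂ) (a : Fin M → ℂ) (i : Fin k) :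
    (derivMatrix M z).mulVec a i = (derivative (coeffPoly a)).eval (z i) := by
  simp only [coeffPoly, derivative_sum, eval_finsetSum, Matrix.mulVec, dotProduct, derivMatrix,
    Matrix.of_apply, derivative_C_mul_X_pow, eval_mul, eval_C, eval_pow, eval_X]
  exact Finset.sum_congr rfl fun m _ => by ring

/-- The first `k` columns form an invertible Vandermonde matrix, so the rows are independent. -/
theorem posDef_evalMatrix {z : Fin k → ℂ} (hz : Function.Injective z) (hM : k ≤ M) :
    (evalMatrix M z * (evalMatrix M z).conjTranspose).PosDef := by
  refine Matrix.PosDef.mul_conjTranspose_self _ ?_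
  have hV : IsUnit (Matrix.vandermonde z) := by
    rw [Matrix.isUnit_iff_isUnit_det]
    exact (Matrix.det_vandermonde_ne_zero_iff.2 hz).isUnit
  have hinj := Matrix.vecMul_injective_of_isUnit hV
  intro x y hxy
  refine hinj ?_
  funext j
  have := congrFun hxy (Fin.castLE hM j)
  simpa [Matrix.vecMul, dotProduct, evalMatrix, Matrix.vandermonde_apply] using this

theorem eval_rootPoly_self (z : Fin k → ℂ) (i : Fin k) : (rootPoly z).eval (z i) = 0 := by
  simp only [rootPoly, eval_prod]
  exact Finset.prod_eq_zero (Finset.mem_univ i) (by simp)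

/-- Both sides are the product of `‖z i - z j‖` over ordered pairs `i ≠ j`. -/
theorem prod_norm_derivative_rootPoly (z : Fin k → ℂ) :
    ∏ i, ‖(derivative (rootPoly z)).eval (z i)‖ = ‖(Matrix.vandermonde z).det‖ ^ 2 := by
  induction k with
  | zero => simp
  | succ k ih =>
    obtain ⟨w, z, rfl⟩ : ∃ w z', z = Fin.cons w z' := ⟨z 0, Fin.tail z, (Fin.cons_self_tail z).symm⟩
    have h1 : ∀ x, (derivative (rootPoly (Fin.cons w z : Fin (k + 1) → ℂ))).eval x =
        (rootPoly z).eval x + (x - w) * (derivative (rootPoly z)).eval x := by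
      intro x
      rw [rootPoly_cons, derivative_mul]
      simp
    rw [Fin.prod_univ_succ]
    simp only [h1, Fin.cons_zero, Fin.cons_succ, sub_self, zero_mul, add_zero, eval_rootPoly_self,
      zero_add,
      norm_mul, Finset.prod_mul_distrib, ih]
    simp only [Matrix.det_vandermonde, Fin.prod_univ_succ, Fin.cons_zero, Fin.cons_succ, norm_mul,
      Fin.Ioi_zero_eq_map, Finset.prod_map, Fin.coe_succEmb, Fin.Ioi_succ, norm_prod,
      norm_rootPoly_eval]
    ring

/-- The matrix of `(u, b) ↦ S u + rootPoly z * coeffPoly b`. -/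
noncomputable def sectionMatrix (z : Fin k → ℂ) (S : Matrix (Fin (k + N)) (Fin k) ℂ) :
    Matrix (Fin k ⊕ Fin N) (Fin k ⊕ Fin N) ℂ :=
  Matrix.of fun x => Sum.elim (fun j => S (finSumFinEquiv x) j)
    fun l => (rootPoly z * X ^ (l : ℕ)).coeff (finSumFinEquiv x)

theorem det_sectionMatrix (z : Fin k → ℂ) {S : Matrix (Fin (k + N)) (Fin k) ℂ}
    (hS : evalMatrix (k + N) z * S = 1) :
    (Matrix.vandermonde z).det * (sectionMatrix z S).det = 1 := by
  -- The first rows of `W` evaluate at the points and the last read off the coefficients of index at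
  -- least `k`. `W` is block upper triangular with determinant that of the Vandermonde matrix, and
  -- its product with `sectionMatrix z S` is block lower triangular with determinant `1`.
  let W : Matrix (Fin k ⊕ Fin N) (Fin k ⊕ Fin N) ℂ :=
    Matrix.of (Sum.elim (fun i x => z i ^ (finSumFinEquiv x : ℕ))
      fun m x => if (finSumFinEquiv x : Fin (k + N)) = finSumFinEquiv (Sum.inr m) then 1 else 0)
  have hW : W = Matrix.fromBlocks (Matrix.vandermonde z)
      (Matrix.of fun (i : Fin k) (m : Fin N) => z i ^ (k + (m : ℕ))) 0 1 := by
    ext (i | m) (j | l)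
    · simp [W, Matrix.vandermonde_apply]
    · simp [W]
    · have h : (finSumFinEquiv (Sum.inl j) : Fin (k + N)) ≠ finSumFinEquiv (Sum.inr m) :=
        finSumFinEquiv.injective.ne Sum.inl_ne_inr
      exact if_neg h
    · simp [W, Matrix.one_apply, eq_comm]
  have hprod : W * sectionMatrix z S = Matrix.fromBlocks 1 0
      (Matrix.of fun (m : Fin N) j => S (Fin.natAdd k m) j) (tailMatrix N z) := by
    ext (i | m) (j | l)
    · rw [Matrix.mul_apply, Matrix.fromBlocks_apply₁₁, ← hS, Matrix.mul_apply,
        ← Equiv.sum_comp finSumFinEquiv]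
      rfl
    · have hd : (rootPoly z * X ^ (l : ℕ)).degree < ((k + N : ℕ) : WithBot ℕ) := by
        rw [degree_mul, rootPoly_degree, degree_X_pow]
        exact_mod_cast Nat.add_lt_add_left l.2 k
      have h1 := coeffPoly_eval (fun i : Fin (k + N) => (rootPoly z * X ^ (l : ℕ)).coeff i) (z i)
      rw [coeffPoly_coeff_eq hd, eval_mul, eval_rootPoly_self, zero_mul] at h1
      rw [Matrix.mul_apply, Matrix.fromBlocks_apply₁₂, Matrix.zero_apply, h1,
        ← Equiv.sum_comp finSumFinEquiv]
      exact Finset.sum_congr rfl fun x _ => mul_comm _ _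
    · rw [Matrix.mul_apply, Matrix.fromBlocks_apply₂₁,
        Finset.sum_eq_single (Sum.inr m) (fun x _ hx => ?_) (by simp)]
      · simp [W, sectionMatrix]
      · simp only [W, Matrix.of_apply, Sum.elim_inr, finSumFinEquiv.injective.eq_iff, if_neg hx,
          zero_mul]
    · rw [Matrix.mul_apply, Matrix.fromBlocks_apply₂₂,
        Finset.sum_eq_single (Sum.inr m) (fun x _ hx => ?_) (by simp)]
      · simp [W, sectionMatrix, tailMatrix, add_comm]
      · simp only [W, Matrix.of_apply, Sum.elim_inr, finSumFinEquiv.injective.eq_iff, if_neg hx,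
          zero_mul]
  have h1 := congrArg Matrix.det hprod
  rw [Matrix.det_mul, Matrix.det_fromBlocks_zero₁₂, hW, Matrix.det_fromBlocks_zero₂₁,
    Matrix.det_one, Matrix.det_one, det_tailMatrix, mul_one, one_mul] at h1
  exact h1

theorem sectionMatrix_mulVec (z : Fin k → ℂ) (S : Matrix (Fin (k + N)) (Fin k) ℂ) (u : Fin k → ℂ)
    (b : Fin N → ℂ) :
    (sectionMatrix z S).mulVec (Sum.elim u b) ∘ finSumFinEquiv.symm =
      S.mulVec u + fun i : Fin (k + N) => (rootPoly z * coeffPoly b).coeff i := by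
  funext i
  rw [Function.comp_apply, Matrix.mulVec, dotProduct, Fintype.sum_sum_type, Pi.add_apply]
  congr 1
  · simp [sectionMatrix, Matrix.mulVec, dotProduct]
  · simp only [sectionMatrix, Matrix.of_apply, Sum.elim_inr, Equiv.apply_symm_apply, coeffPoly,
      Finset.mul_sum, finsetSum_coeff]
    refine Finset.sum_congr rfl fun l _ => ?_
    rw [mul_left_comm, coeff_C_mul, mul_comm]

/-- Integration along the kernel of evaluation and a section of it. -/
theorem lintegral_section {z : Fin k → ℂ} {S : Matrix (Fin (k + N)) (Fin k) ℂ}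
    (hS : evalMatrix (k + N) z * S = 1) {f : (Fin (k + N) → ℂ) → ℝ≥0∞} (hf : Measurable f) :
    ENNReal.ofReal (‖(Matrix.vandermonde z).det‖ ^ 2) * ∫⁻ a, f a =
      ∫⁻ u : Fin k → ℂ, ∫⁻ b : Fin N → ℂ,
      f (S.mulVec u + fun i : Fin (k + N) => (rootPoly z * coeffPoly b).coeff i) := by
  have hdet := det_sectionMatrix z hS
  have h0 : (sectionMatrix z S).det ≠ 0 := right_ne_zero_of_mul_eq_one hdet
  rw [lintegral_comp_finSumFinEquiv hf, lintegral_mulVec (sectionMatrix z S) h0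
    fun x => f (x ∘ finSumFinEquiv.symm), ← mul_assoc, ← ENNReal.ofReal_mul (by positivity),
    ← mul_pow, ← norm_mul, hdet, norm_one, one_pow, ENNReal.ofReal_one, one_mul,
    lintegral_sum_elim]
  · simp_rw [sectionMatrix_mulVec]
  · have h1 : Measurable fun x : Fin k ⊕ Fin N → ℂ =>
        (sectionMatrix z S).mulVec x ∘ finSumFinEquiv.symm := by
      refine Continuous.measurable (continuous_pi fun i => ?_)
      exact (continuous_apply (finSumFinEquiv.symm i)).comp
        (Continuous.matrix_mulVec continuous_const continuous_id)
    exact hf.comp h1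

end EvaluationMatrices

/-! ### Gaussian integrals of quadratic and product type -/

section GaussianIntegrals

open scoped ComplexOrder MatrixOrder

variable {N k M : ℕ}

theorem lintegral_exp_neg_sum_norm_sq :
    ∫⁻ v : Fin k → ℂ, ENNReal.ofReal (Real.exp (-∑ i, ‖v i‖ ^ 2)) =
      ENNReal.ofReal (Real.pi ^ k) := by
  have h1 : ∫⁻ v : Fin k → ℂ, ENNReal.ofReal (gaussDensity v) = 1 := by
    simp_rw [ofReal_gaussDensity]
    rw [lintegral_pi_prod fun _ => measurable_stdDensity]
    simp [lintegral_stdDensity]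
  have h2 : ∀ v : Fin k → ℂ, ENNReal.ofReal (Real.exp (-∑ i, ‖v i‖ ^ 2)) =
      ENNReal.ofReal (Real.pi ^ k) * ENNReal.ofReal (gaussDensity v) := fun v => by
    rw [← ENNReal.ofReal_mul (by positivity), gaussDensity, mul_div_cancel₀ _ (by positivity)]
  simp_rw [h2]
  rw [lintegral_const_mul' _ _ ENNReal.ofReal_ne_top, h1, mul_one]

/-- A square root `Y` of the Gram matrix gives `‖X u‖ = ‖Y u‖` with `Y` square, so a linear change
of variables applies. -/
theorem lintegral_exp_neg_sum_norm_sq_mulVec {X : Matrix (Fin M) (Fin k) ℂ}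
    (hX : (X.conjTranspose * X).PosDef) :
    ENNReal.ofReal ‖(X.conjTranspose * X).det‖ *
      ∫⁻ u : Fin k → ℂ, ENNReal.ofReal (Real.exp (-∑ m, ‖X.mulVec u m‖ ^ 2)) =
      ENNReal.ofReal (Real.pi ^ k) := by
  obtain ⟨Y, hY⟩ := CStarAlgebra.nonneg_iff_eq_star_mul_self.1 hX.posSemidef.nonneg
  rw [Matrix.star_eq_conjTranspose] at hY
  have hdet : ‖(X.conjTranspose * X).det‖ = ‖Y.det‖ ^ 2 := by
    rw [hY, Matrix.det_mul, Matrix.det_conjTranspose, norm_mul, norm_star, sq]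
  have hY0 : Y.det ≠ 0 := by
    have h := hX.det_pos.ne'
    rw [← norm_ne_zero_iff, hdet] at h
    exact norm_ne_zero_iff.1 (pow_ne_zero_iff two_ne_zero |>.1 h)
  simp_rw [sum_norm_sq_mulVec_congr hY]
  rw [hdet, ← lintegral_mulVec Y hY0 fun v => ENNReal.ofReal (Real.exp (-∑ i, ‖v i‖ ^ 2)),
    lintegral_exp_neg_sum_norm_sq]

theorem prod_mul_conj_eq (v : Fin k → ℂ) :
    ∏ i, (v i * conj (v i)) = ((∏ i, ‖v i‖ ^ 2 : ℝ) : ℂ) := by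
  push_cast
  exact Finset.prod_congr rfl fun i _ => Complex.mul_conj' _

theorem integrable_prod_norm_sq_mulVec (L : Matrix (Fin k) (Fin M) ℂ) :
    Integrable (fun a => ∏ i, ‖L.mulVec a i‖ ^ 2) (Measure.pi fun _ => stdComplexGaussian) := by
  have h := (integrable_prod_mulVec L).re
  simp_rw [prod_mul_conj_eq] at h
  exact h

theorem lintegral_gaussDensity_mul_prod_norm_sq (L : Matrix (Fin k) (Fin M) ℂ) :
    ∫⁻ a, ENNReal.ofReal (gaussDensity a) * ENNReal.ofReal (∏ i, ‖L.mulVec a i‖ ^ 2) =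
      ENNReal.ofReal (∫ a, ∏ i, ‖L.mulVec a i‖ ^ 2 ∂(Measure.pi fun _ => stdComplexGaussian)) := by
  rw [ofReal_integral_eq_lintegral_ofReal (integrable_prod_norm_sq_mulVec L)
    (Eventually.of_forall fun a => by positivity), pi_stdComplexGaussian,
    lintegral_withDensity_eq_lintegral_mul₀
      continuous_gaussDensity.measurable.ennreal_ofReal.aemeasurable]
  · rfl
  · refine Measurable.aemeasurable (Measurable.ennreal_ofReal (Continuous.measurable ?_))
    refine continuous_finsetProd _ fun i _ => Continuous.pow (Continuous.norm ?_) 2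
    exact (continuous_apply i).comp (Continuous.matrix_mulVec continuous_const continuous_id)

theorem ofReal_integral_prod_norm_sq_mulVec (L : Matrix (Fin k) (Fin M) ℂ) :
    ((∫ a, ∏ i, ‖L.mulVec a i‖ ^ 2 ∂(Measure.pi fun _ => stdComplexGaussian) : ℝ) : ℂ) =
      (L * L.conjTranspose).permanent := by
  rw [← integral_prod_mulVec, ← integral_complex_ofReal]
  simp_rw [prod_mul_conj_eq]

variable {Ω : Type*} [MeasurableSpace Ω] {P : Measure Ω} {G : ℕ → Ω → ℂ}

theorem integrable_rootIntegrand_truncate (hlaw : ∀ i, HasLaw (G i) stdComplexGaussian P)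
    (hindep : iIndepFun G P) (q r : Fin k → ℕ → ℂ) :
    Integrable (fun ω => rootIntegrand (truncate N q) (truncate N r) fun m => G (k + m) ω) P := by
  have hX : AEMeasurable (fun ω m => G (k + m) ω) P :=
    aemeasurable_pi_lambda _ fun m => (hlaw (k + m)).aemeasurable
  refine ⟨((measurable_rootIntegrand _ _).comp_aemeasurable hX).aestronglyMeasurable, ?_⟩
  rw [hasFiniteIntegral_iff_ofReal (Eventually.of_forall fun _ => rootIntegrand_nonneg _ _ _)]
  let L : Matrix (Fin k) (Fin N) ℂ := Matrix.of fun i m => q i m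
  have hu : Function.Injective fun m : Fin N => k + (m : ℕ) := fun a b h =>
    Fin.ext (Nat.add_left_cancel h)
  have hL : Measurable fun a : Fin N → ℂ => ENNReal.ofReal (∏ i, ‖L.mulVec a i‖ ^ 2) := by
    refine Measurable.ennreal_ofReal (Continuous.measurable ?_)
    refine continuous_finsetProd _ fun i _ => Continuous.pow (Continuous.norm ?_) 2
    exact (continuous_apply i).comp (Continuous.matrix_mulVec continuous_const continuous_id)
  calc _ ≤ ∫⁻ ω, ENNReal.ofReal (∏ i, ‖L.mulVec (fun m : Fin N => G (k + m) ω) i‖ ^ 2) ∂P := by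
        refine lintegral_mono fun ω => ENNReal.ofReal_le_ofReal ?_
        rw [rootIntegrand]
        simp only [tsum_truncate]
        have h1 : ∀ i, L.mulVec (fun m : Fin N => G (k + m) ω) i =
            ∑ m : Fin N, G (k + m) ω * q i m := fun i => by
          simp only [L, Matrix.mulVec, dotProduct, Matrix.of_apply, mul_comm]
        simp only [h1]
        refine mul_le_of_le_one_right (by positivity) ?_
        rw [Real.exp_le_one_iff, neg_nonpos]
        positivity
    _ < ∞ := by
        rw [lintegral_gaussian hlaw hindep (u := fun m : Fin N => k + (m : ℕ)) hu hL.aemeasurable,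
          lintegral_gaussDensity_mul_prod_norm_sq]
        exact ENNReal.ofReal_lt_top

theorem lintegral_rootWeight_eq_corrDensity (hM : M = N + k)
    (hlaw : ∀ i, HasLaw (G i) stdComplexGaussian P) (hindep : iIndepFun G P) (z : Fin k → ℂ) :
    ∫⁻ b : Fin N → ℂ, ENNReal.ofReal (rootWeight z b) *
        ENNReal.ofReal (gaussDensity fun i : Fin M => (rootPoly z * coeffPoly b).coeff i) =
      ENNReal.ofReal (corrDensity P G N z) := by
  rw [lintegral_rootWeight_mul_gaussDensity hM hlaw hindep, corrDensity,
    ENNReal.ofReal_mul (by positivity), ofReal_integral_eq_lintegral_ofReal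
      (integrable_rootIntegrand_truncate hlaw hindep _ _)
      (Eventually.of_forall fun _ => rootIntegrand_nonneg _ _ _)]

end GaussianIntegrals

/-! ### Permanent-determinant formula for finite `N` -/

section DeterminantalFormula

open Polynomial
open scoped ComplexOrder

variable {N k M : ℕ} {Ω : Type*} [MeasurableSpace Ω] {P : Measure Ω} {G : ℕ → Ω → ℂ}

theorem prod_norm_sq_derivMatrix_mulVec (z : Fin k → ℂ) (b : Fin N → ℂ) (hM : M = N + k) :
    ∏ i, ‖(derivMatrix M z).mulVec (fun m => (rootPoly z * coeffPoly b).coeff m) i‖ ^ 2 =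
      ‖(Matrix.vandermonde z).det‖ ^ 2 * rootWeight z b := by
  subst hM
  simp only [derivMatrix_mulVec, coeffPoly_coeff_eq (rootPoly_mul_degree_lt z b), derivative_mul,
    eval_add, eval_mul, eval_rootPoly_self, zero_mul, add_zero, norm_mul, mul_pow,
    Finset.prod_mul_distrib, rootWeight]
  rw [Finset.prod_pow, prod_norm_derivative_rootPoly]
  ring

/-- The correlation functions of the roots as a conditional Gaussian expectation. -/
theorem corrDensity_eq_permanent_div_det
    (hlaw : ∀ i, HasLaw (G i) stdComplexGaussian P) (hindep : iIndepFun G P) {z : Fin k → ℂ}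
    (hz : Function.Injective z) (N : ℕ) :
    (corrDensity P G N z : ℂ) =
      (derivMatrix (k + N) z * (derivMatrix (k + N) z).conjTranspose -
        derivMatrix (k + N) z * (evalMatrix (k + N) z).conjTranspose *
        (evalMatrix (k + N) z * (evalMatrix (k + N) z).conjTranspose)⁻¹ *
        (derivMatrix (k + N) z * (evalMatrix (k + N) z).conjTranspose).conjTranspose).permanent /
      ((Real.pi : ℂ) • (evalMatrix (k + N) z * (evalMatrix (k + N) z).conjTranspose)).det := by
  have hA := posDef_evalMatrix hz (Nat.le_add_right k N)
  set E := evalMatrix (k + N) z with hE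
  set D := derivMatrix (k + N) z with hD
  set A := E * E.conjTranspose with hAdef
  have hAu : IsUnit A.det := hA.det_pos.ne'.isUnit
  have hAi : A * A⁻¹ = 1 := Matrix.mul_nonsing_inv _ hAu
  have hiA : A⁻¹ * A = 1 := Matrix.nonsing_inv_mul _ hAu
  -- The section of `E` whose range is orthogonal to `ker E`.
  let S := E.conjTranspose * A⁻¹
  have hSdef : S = E.conjTranspose * A⁻¹ := rfl
  have hES : E * S = 1 := by rw [hSdef, ← Matrix.mul_assoc, ← hAdef, hAi]
  have hSH : S.conjTranspose = A⁻¹ * E := by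
    rw [hSdef, Matrix.conjTranspose_mul, Matrix.conjTranspose_conjTranspose,
      hA.inv.isHermitian.eq]
  have hSS : S.conjTranspose * S = A⁻¹ := by
    rw [hSH, Matrix.mul_assoc, hES, Matrix.mul_one]
  -- The derivative values minus their conditional expectation given the values at the points: `L`
  -- vanishes on the range of `S` and equals `D` on `ker E`.
  let L := D - D * S * E
  have hLdef : L = D - D * S * E := rfl
  have hLS : L * S = 0 := by
    rw [hLdef, Matrix.sub_mul, Matrix.mul_assoc _ E S, hES, Matrix.mul_one, sub_self]
  have hLE : L * E.conjTranspose = 0 := by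
    rw [hLdef, Matrix.sub_mul, Matrix.mul_assoc _ E, ← hAdef, hSdef, Matrix.mul_assoc D,
      Matrix.mul_assoc E.conjTranspose, hiA, Matrix.mul_one, sub_self]
  have hLL : L * L.conjTranspose = D * D.conjTranspose -
      D * E.conjTranspose * A⁻¹ * (D * E.conjTranspose).conjTranspose := by
    have h1 : L.conjTranspose = D.conjTranspose - E.conjTranspose * (D * S).conjTranspose := by
      rw [hLdef, Matrix.conjTranspose_sub, Matrix.conjTranspose_mul (D * S)]
    rw [h1, Matrix.mul_sub, ← Matrix.mul_assoc, hLE, Matrix.zero_mul, sub_zero, hLdef,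
      Matrix.sub_mul, hSdef, Matrix.conjTranspose_mul, Matrix.conjTranspose_conjTranspose]
    simp only [Matrix.mul_assoc]
  let c : (Fin N → ℂ) → Fin (k + N) → ℂ := fun b i => (rootPoly z * coeffPoly b).coeff i
  have hEc : ∀ b, E.mulVec (c b) = 0 := by
    intro b
    funext i
    rw [hE, evalMatrix_mulVec, coeffPoly_coeff_eq
      (by rw [add_comm k N]; exact rootPoly_mul_degree_lt z b), eval_mul, eval_rootPoly_self,
      zero_mul]
    rfl
  have hLc : ∀ u b, L.mulVec (S.mulVec u + c b) = D.mulVec (c b) := by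
    intro u b
    rw [Matrix.mulVec_add, Matrix.mulVec_mulVec, hLS, Matrix.zero_mulVec, zero_add, hLdef,
      Matrix.sub_mulVec, ← Matrix.mulVec_mulVec, hEc, Matrix.mulVec_zero, sub_zero]
  have horth : ∀ u b, star (S.mulVec u) ⬝ᵥ c b = 0 := by
    intro u b
    rw [Matrix.star_mulVec, ← Matrix.dotProduct_mulVec, hSH, ← Matrix.mulVec_mulVec, hEc,
      Matrix.mulVec_zero, dotProduct_zero]
  have hg : ∀ u b, gaussDensity (S.mulVec u + c b) =
      Real.exp (-∑ m, ‖S.mulVec u m‖ ^ 2) * gaussDensity (c b) := by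
    intro u b
    rw [gaussDensity, gaussDensity, sum_norm_sq_add (horth u b), neg_add, Real.exp_add,
      mul_div_assoc]
  set V := ENNReal.ofReal (‖(Matrix.vandermonde z).det‖ ^ 2) with hV
  have hV0 : V ≠ 0 := by
    rw [hV, Ne, ENNReal.ofReal_eq_zero, not_le]
    have := norm_pos_iff.2 (Matrix.det_vandermonde_ne_zero_iff.2 hz)
    positivity
  set r := ∫ a, ∏ i, ‖L.mulVec a i‖ ^ 2 ∂(Measure.pi fun _ => stdComplexGaussian) with hr
  set K := ∫⁻ u : Fin k → ℂ, ENNReal.ofReal (Real.exp (-∑ m, ‖S.mulVec u m‖ ^ 2)) with hK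
  have hLcont : Continuous fun a : Fin (k + N) → ℂ => ∏ i, ‖L.mulVec a i‖ ^ 2 := by
    refine continuous_finsetProd _ fun i _ => Continuous.pow (Continuous.norm ?_) 2
    exact (continuous_apply i).comp (Continuous.matrix_mulVec continuous_const continuous_id)
  have hf : Measurable fun a : Fin (k + N) → ℂ =>
      ENNReal.ofReal (gaussDensity a) * ENNReal.ofReal (∏ i, ‖L.mulVec a i‖ ^ 2) :=
    continuous_gaussDensity.measurable.ennreal_ofReal.mul hLcont.measurable.ennreal_ofReal
  have hfub : ∀ u b, ENNReal.ofReal (gaussDensity (S.mulVec u + c b)) *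
      ENNReal.ofReal (∏ i, ‖L.mulVec (S.mulVec u + c b) i‖ ^ 2) =
      ENNReal.ofReal (Real.exp (-∑ m, ‖S.mulVec u m‖ ^ 2)) * V *
        (ENNReal.ofReal (rootWeight z b) * ENNReal.ofReal (gaussDensity (c b))) := by
    intro u b
    rw [hLc, hg, prod_norm_sq_derivMatrix_mulVec z b (add_comm k N),
      ENNReal.ofReal_mul (Real.exp_pos _).le, ENNReal.ofReal_mul (sq_nonneg _)]
    ring
  -- The Gaussian integral of `∏ |(L a)_i|²` is computed in the coordinates `(u, b)`: the density
  -- factors by orthogonality, and `L` sees only `b`. Both sides carry the Vandermonde factor `V`,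
  -- nonzero at distinct points.
  have key : V * ENNReal.ofReal r = V * (K * ENNReal.ofReal (corrDensity P G N z)) := by
    rw [hr, ← lintegral_gaussDensity_mul_prod_norm_sq, hV, lintegral_section hES hf,
      lintegral_congr fun u => lintegral_congr fun b => hfub u b]
    have h1 : ∀ u : Fin k → ℂ, ∫⁻ b : Fin N → ℂ,
        ENNReal.ofReal (Real.exp (-∑ m, ‖S.mulVec u m‖ ^ 2)) * V *
          (ENNReal.ofReal (rootWeight z b) * ENNReal.ofReal (gaussDensity (c b))) =
        ENNReal.ofReal (Real.exp (-∑ m, ‖S.mulVec u m‖ ^ 2)) *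
          (V * ENNReal.ofReal (corrDensity P G N z)) := by
      intro u
      rw [lintegral_const_mul' _ _ (ENNReal.mul_ne_top ENNReal.ofReal_ne_top
        ENNReal.ofReal_ne_top), mul_assoc,
        ← lintegral_rootWeight_eq_corrDensity (add_comm k N) hlaw hindep]
    simp_rw [h1]
    rw [lintegral_mul_const' _ _ (ENNReal.mul_ne_top ENNReal.ofReal_ne_top
      ENNReal.ofReal_ne_top), ← hK, ← hV, mul_left_comm]
  have key' := (ENNReal.mul_right_inj hV0 ENNReal.ofReal_ne_top).1 key
  have hSpos : (S.conjTranspose * S).PosDef := hSS ▸ hA.inv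
  have hdetS : (S.conjTranspose * S).det * A.det = 1 := by
    rw [hSS, ← Matrix.det_mul, hiA, Matrix.det_one]
  have hKint := lintegral_exp_neg_sum_norm_sq_mulVec hSpos
  rw [← hK] at hKint
  have hr0 : 0 ≤ r := integral_nonneg fun a => by positivity
  -- Since `S* S = A⁻¹`, the integral `K` over `u` equals `π ^ k det A`, the denominator of the
  -- formula.
  have hfin : ‖(S.conjTranspose * S).det‖ * r = Real.pi ^ k * corrDensity P G N z := by
    have h : ENNReal.ofReal ‖(S.conjTranspose * S).det‖ * ENNReal.ofReal r =
        ENNReal.ofReal ‖(S.conjTranspose * S).det‖ *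
          (K * ENNReal.ofReal (corrDensity P G N z)) := by rw [key']
    rw [← mul_assoc, hKint, ← ENNReal.ofReal_mul (norm_nonneg _),
      ← ENNReal.ofReal_mul (by positivity)] at h
    exact (ENNReal.ofReal_eq_ofReal_iff (by positivity)
      (mul_nonneg (by positivity) (corrDensity_nonneg _ _))).1 h
  have hfin' := congrArg (fun x : ℝ => (x : ℂ)) hfin
  simp only [Complex.ofReal_mul, Complex.ofReal_pow] at hfin'
  rw [← Complex.eq_coe_norm_of_nonneg hSpos.det_pos.le, ofReal_integral_prod_norm_sq_mulVec,
    hLL] at hfin'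
  rw [Matrix.det_smul, Fintype.card_fin, eq_div_iff (mul_ne_zero
    (pow_ne_zero _ (Complex.ofReal_ne_zero.2 Real.pi_ne_zero)) hAu.ne_zero)]
  linear_combination (-A.det) * hfin' + (D * D.conjTranspose -
      D * E.conjTranspose * A⁻¹ * (D * E.conjTranspose).conjTranspose).permanent * hdetS

end DeterminantalFormula

/-! ### Limits of the covariance matrices -/

section LimitingCovariances

open scoped ComplexOrder

variable {k : ℕ}

theorem hasSum_evalMatrix {z w : ℂ} (h : ‖z * w‖ < 1) :
    HasSum (fun m : ℕ => z ^ m * w ^ m) (hInf (z * w)) := by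
  have h1 := hasSum_geometric_of_norm_lt_one h
  simp_rw [mul_pow] at h1
  rwa [hInf, one_div]

theorem hasSum_succ_mul_pow {x : ℂ} (h : ‖x‖ < 1) :
    HasSum (fun n : ℕ => ((n : ℂ) + 1) * x ^ n) (gInf x) := by
  have h1 := hasSum_choose_mul_geometric_of_norm_lt_one 1 h
  simpa [gInf] using h1

theorem hasSum_succ_sq_mul_pow {x : ℂ} (h : ‖x‖ < 1) :
    HasSum (fun n : ℕ => ((n : ℂ) + 1) ^ 2 * x ^ n) (gInf x + x * fInf x) := by
  -- This uses `(n + 1) ^ 2 = 2 * choose (n + 2) 2 - (n + 1)`.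
  have h1 := ((hasSum_choose_mul_geometric_of_norm_lt_one 2 h).mul_left 2).sub
    (hasSum_succ_mul_pow h)
  have h0 : (1 : ℂ) - x ≠ 0 := by
    intro h0
    rw [← sub_eq_zero.1 h0, norm_one] at h
    exact lt_irrefl _ h
  convert! h1 using 1
  · funext n
    rw [Nat.cast_choose_two]
    push_cast
    ring
  · rw [gInf, fInf]
    field_simp
    ring

theorem hasSum_derivMatrix_evalMatrix {z w : ℂ} (h : ‖z * w‖ < 1) :
    HasSum (fun m : ℕ => (m : ℂ) * z ^ (m - 1) * w ^ m) (w * gInf (z * w)) := by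
  rw [← hasSum_nat_add_iff' 1]
  convert! (hasSum_succ_mul_pow h).mul_left w using 1
  · funext n
    rw [Nat.add_sub_cancel]
    push_cast
    ring
  · simp

theorem hasSum_derivMatrix {z w : ℂ} (h : ‖z * w‖ < 1) :
    HasSum (fun m : ℕ => (m : ℂ) * z ^ (m - 1) * (m * w ^ (m - 1)))
      (gInf (z * w) + z * w * fInf (z * w)) := by
  rw [← hasSum_nat_add_iff' 1]
  convert! hasSum_succ_sq_mul_pow h using 1
  · funext n
    rw [Nat.add_sub_cancel]
    push_cast
    ring
  · simp

theorem tendsto_sum_fin_add {f : ℕ → ℂ} {a : ℂ} (h : HasSum f a) (k : ℕ) :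
    Tendsto (fun N => ∑ m : Fin (k + N), f m) atTop (𝓝 a) := by
  simp_rw [Fin.sum_univ_eq_sum_range f]
  refine h.tendsto_sum_nat.comp ?_
  exact tendsto_atTop_mono (fun N => Nat.le_add_left N k) tendsto_id

variable {z : Fin k → ℂ}

theorem norm_mul_conj_lt_one (hz : ∀ i, ‖z i‖ < 1) (i j : Fin k) : ‖z i * conj (z j)‖ < 1 := by
  rw [norm_mul, RCLike.norm_conj]
  exact mul_lt_one_of_nonneg_of_lt_one_left (norm_nonneg _) (hz i) (hz j).le

theorem tendsto_evalMatrix (hz : ∀ i, ‖z i‖ < 1) :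
    Tendsto (fun N => evalMatrix (k + N) z * (evalMatrix (k + N) z).conjTranspose) atTop
      (𝓝 (covA z)) := by
  refine tendsto_pi_nhds.2 fun i => tendsto_pi_nhds.2 fun j => ?_
  have h := tendsto_sum_fin_add (hasSum_evalMatrix (norm_mul_conj_lt_one hz i j)) k
  simpa [Matrix.mul_apply, evalMatrix, covA] using h

theorem tendsto_derivMatrix_evalMatrix (hz : ∀ i, ‖z i‖ < 1) :
    Tendsto (fun N => derivMatrix (k + N) z * (evalMatrix (k + N) z).conjTranspose) atTop
      (𝓝 (covB z)) := by
  refine tendsto_pi_nhds.2 fun i => tendsto_pi_nhds.2 fun j => ?_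
  have h := tendsto_sum_fin_add (hasSum_derivMatrix_evalMatrix (norm_mul_conj_lt_one hz i j)) k
  simpa [Matrix.mul_apply, evalMatrix, derivMatrix, covB] using h

theorem tendsto_derivMatrix (hz : ∀ i, ‖z i‖ < 1) :
    Tendsto (fun N => derivMatrix (k + N) z * (derivMatrix (k + N) z).conjTranspose) atTop
      (𝓝 (covC z)) := by
  refine tendsto_pi_nhds.2 fun i => tendsto_pi_nhds.2 fun j => ?_
  have h := tendsto_sum_fin_add (hasSum_derivMatrix (norm_mul_conj_lt_one hz i j)) k
  simpa [Matrix.mul_apply, derivMatrix, covC] using h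

theorem dotProduct_evalMatrix_mono (x : Fin k → ℂ) {M M' : ℕ} (h : M ≤ M') :
    star x ⬝ᵥ (evalMatrix M z * (evalMatrix M z).conjTranspose).mulVec x ≤
      star x ⬝ᵥ (evalMatrix M' z * (evalMatrix M' z).conjTranspose).mulVec x := by
  have h1 : ∀ M, star x ⬝ᵥ (evalMatrix M z * (evalMatrix M z).conjTranspose).mulVec x =
      ((∑ m ∈ Finset.range M, ‖∑ i, conj (z i ^ m) * x i‖ ^ 2 : ℝ) : ℂ) := by
    intro M
    have h2 := sum_norm_sq_mulVec (evalMatrix M z).conjTranspose x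
    rw [Matrix.conjTranspose_conjTranspose] at h2
    rw [← h2, Finset.sum_range]
    rfl
  rw [h1, h1, Complex.real_le_real]
  exact Finset.sum_le_sum_of_subset_of_nonneg (Finset.range_mono h) fun _ _ _ => by positivity

/-- The quadratic forms of the truncated Gram matrices increase with the truncation and are already
positive definite at size `k`, so the limiting form has no kernel. -/
theorem det_covA_ne_zero (hz : ∀ i, ‖z i‖ < 1) (hinj : Function.Injective z) :
    (covA z).det ≠ 0 := by
  intro h0
  obtain ⟨x, hx, hx0⟩ := Matrix.exists_mulVec_eq_zero_iff.2 h0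
  have hpos := (posDef_evalMatrix hinj le_rfl).dotProduct_mulVec_pos hx
  have hlim : Tendsto (fun N => star x ⬝ᵥ
      (evalMatrix (k + N) z * (evalMatrix (k + N) z).conjTranspose).mulVec x) atTop
      (𝓝 (star x ⬝ᵥ (covA z).mulVec x)) := by
    have hc : Continuous fun A : Matrix (Fin k) (Fin k) ℂ => star x ⬝ᵥ A.mulVec x :=
      continuous_const.dotProduct (continuous_id.matrix_mulVec continuous_const)
    exact (hc.tendsto _).comp (tendsto_evalMatrix hz)
  rw [hx0, dotProduct_zero] at hlim
  exact (ge_of_tendsto' hlim fun N =>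
    dotProduct_evalMatrix_mono x (Nat.le_add_right k N)).not_gt hpos

variable {Ω : Type*} [MeasurableSpace Ω] {P : Measure Ω} {G : ℕ → Ω → ℂ}

theorem continuous_permanent :
    Continuous (Matrix.permanent : Matrix (Fin k) (Fin k) ℂ → ℂ) := by
  unfold Matrix.permanent
  exact continuous_finsetSum _ fun σ _ => continuous_finsetProd _ fun i _ =>
    continuous_id.matrix_elem _ _

theorem tendsto_corrDensity_apply [IsProbabilityMeasure P]
    (hlaw : ∀ i, HasLaw (G i) stdComplexGaussian P) (hz : ∀ i, ‖z i‖ < 1) :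
    Tendsto (fun N => corrDensity P G N z) atTop (𝓝 (corrDensityLimit P G z)) := by
  have h : Tendsto (fun N : ℕ => (N, z)) atTop (atTop ×ˢ 𝓝 z) :=
    Tendsto.prodMk tendsto_id tendsto_const_nhds
  have h1 := Tendsto.comp (tendsto_corrDensity hlaw hz) h
  simp only [Function.comp_def] at h1
  exact h1

/-- At distinct points this is the limit of the formula for finite `N`; otherwise the Vandermonde
factor is zero. -/
theorem corrDensityLimit_eq_rhoInf [IsProbabilityMeasure P]
    (hlaw : ∀ i, HasLaw (G i) stdComplexGaussian P) (hindep : iIndepFun G P)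
    (hz : ∀ i, ‖z i‖ < 1) : (corrDensityLimit P G z : ℂ) = rhoInf k z := by
  rw [rhoInf]
  split_ifs with hinj
  · have hdet := det_covA_ne_zero hz hinj
    have h1 := (Complex.continuous_ofReal.tendsto _).comp (tendsto_corrDensity_apply hlaw hz)
    refine tendsto_nhds_unique h1 ?_
    simp_rw [Function.comp_def, corrDensity_eq_permanent_div_det hlaw hindep hinj]
    have hA := tendsto_evalMatrix hz
    have hB := tendsto_derivMatrix_evalMatrix hz
    have hC := tendsto_derivMatrix hz
    have hinv := (continuousAt_matrix_inv (covA z)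
      (by rw [Ring.inverse_eq_inv']; exact continuousAt_inv₀ hdet)).tendsto.comp hA
    have hBH : Continuous fun B : Matrix (Fin k) (Fin k) ℂ => B.conjTranspose :=
      continuous_id.matrix_conjTranspose
    refine Tendsto.div ?_ ?_ ?_
    · exact (continuous_permanent.tendsto _).comp
        (hC.sub ((hB.mul hinv).mul ((hBH.tendsto _).comp hB)))
    · exact ((continuous_id.matrix_det).tendsto _).comp (hA.const_smul _)
    · rw [Matrix.det_smul]
      exact mul_ne_zero (pow_ne_zero _ (Complex.ofReal_ne_zero.2 Real.pi_ne_zero)) hdet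
  · have h0 : (Matrix.vandermonde z).det = 0 := by
      by_contra h
      exact hinj (Matrix.det_vandermonde_ne_zero_iff.1 h)
    simp [corrDensityLimit, h0]

end LimitingCovariances

/-! ### Existence, uniqueness and uniform convergence -/

section MainTheorem

variable {k : ℕ} {Ω : Type*} [MeasurableSpace Ω] {P : Measure Ω} {G : ℕ → Ω → ℂ}

/-- Testing on indicators gives equality almost everywhere, and continuity removes the exceptional
set. -/
theorem IsCorrelationFunction.unique {Z : Ω → Multiset ℂ} {ρ ρ' : (Fin k → ℂ) → ℝ}
    (h : IsCorrelationFunction P Z k ρ) (h' : IsCorrelationFunction P Z k ρ') : ρ = ρ' := by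
  rw [← h.continuous.ae_eq_iff_eq volume h'.continuous]
  have hind : ∀ {σ : (Fin k → ℂ) → ℝ}, IsCorrelationFunction P Z k σ →
      ∀ s, MeasurableSet s → ∫⁻ z in s, ENNReal.ofReal (σ z) =
        ∫⁻ ω, sumDistinct k (Z ω) (s.indicator 1) ∂P := by
    intro σ hσ s hs
    rw [hσ.lintegral_eq _ (measurable_one.indicator hs), ← lintegral_indicator hs]
    refine lintegral_congr fun z => ?_
    by_cases hz : z ∈ s <;> simp [hz]
  have hae := ae_eq_of_forall_setLIntegral_eq_of_sigmaFinite (μ := volume)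
    h.continuous.measurable.ennreal_ofReal h'.continuous.measurable.ennreal_ofReal
    fun s hs _ => (hind h s hs).trans (hind h' s hs).symm
  filter_upwards [hae] with z hz
  exact (ENNReal.ofReal_eq_ofReal_iff (h.nonneg z) (h'.nonneg z)).1 hz

theorem isCorrelationFunction_corrDensity [IsProbabilityMeasure P]
    (hlaw : ∀ i, HasLaw (G i) stdComplexGaussian P) (hindep : iIndepFun G P) {n N : ℕ}
    (hN : n + 1 = N + k) :
    IsCorrelationFunction P (fun ω => (kacPolynomial n fun i => G i ω).roots) k
      (corrDensity P G N) where
  continuous := continuous_corrDensity hlaw N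
  nonneg := corrDensity_nonneg N
  lintegral_eq φ hφ := by
    rw [lintegral_sumDistinct hN hlaw hindep hφ]
    simp_rw [lintegral_rootWeight_eq_corrDensity hN hlaw hindep]

theorem card_roots_kacPolynomial_le (n : ℕ) (a : ℕ → ℂ) :
    Multiset.card (kacPolynomial n a).roots ≤ n := by
  refine (Polynomial.card_roots' _).trans ?_
  rw [kacPolynomial_eq_coeffPoly]
  have h := coeffPoly_degree_lt fun i : Fin (n + 1) => a i
  by_cases h0 : coeffPoly (fun i : Fin (n + 1) => a i) = 0
  · simp [h0]
  · exact Nat.lt_succ_iff.1 ((Polynomial.natDegree_lt_iff_degree_lt h0).2 h)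

theorem isCorrelationFunction_zero {n : ℕ} (hn : n < k) :
    IsCorrelationFunction P (fun ω => (kacPolynomial n fun i => G i ω).roots) k 0 where
  continuous := continuous_const
  nonneg _ := le_rfl
  lintegral_eq φ _ := by
    have h : ∀ ω, sumDistinct k (kacPolynomial n fun i => G i ω).roots φ = 0 := by
      intro ω
      refine Finset.sum_eq_zero fun e _ => absurd (Fintype.card_le_of_embedding e) ?_
      rw [Fintype.card_fin, Multiset.card_coe, not_le]
      exact (card_roots_kacPolynomial_le n _).trans_lt hn
    simp [h]

theorem isCompact_setOf_norm_le (k : ℕ) (y : ℝ) : IsCompact {z : Fin k → ℂ | ∀ i, ‖z i‖ ≤ y} := by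
  have h := isCompact_univ_pi fun _ : Fin k => isCompact_closedBall (0 : ℂ) y
  convert h using 1
  ext z
  simp

end MainTheorem

theorem mainTheorem5 {Ω : Type*} [MeasurableSpace Ω] (P : Measure Ω) [IsProbabilityMeasure P]
    (G : ℕ → Ω → ℂ) (hlaw : ∀ i, HasLaw (G i) stdComplexGaussian P) (hindep : iIndepFun G P) :
    (∀ n k : ℕ, ∃! ρ : (Fin k → ℂ) → ℝ,
      IsCorrelationFunction P (fun ω => (kacPolynomial n (fun i => G i ω)).roots) k ρ) ∧
    ∀ (k : ℕ) (ρ : ℕ → (Fin k → ℂ) → ℝ),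
      (∀ n, IsCorrelationFunction P
        (fun ω => (kacPolynomial n (fun i => G i ω)).roots) k (ρ n)) →
      ∀ y : ℝ, y < 1 →
        TendstoUniformlyOn (fun n z => (ρ n z : ℂ)) (rhoInf k) atTop
          {z : Fin k → ℂ | ∀ i, ‖z i‖ ≤ y} := by
  constructor
  · intro n k
    obtain ⟨ρ, hρ⟩ : ∃ ρ : (Fin k → ℂ) → ℝ, IsCorrelationFunction P
        (fun ω => (kacPolynomial n (fun i => G i ω)).roots) k ρ := by
      rcases lt_or_ge n k with h | h
      · exact ⟨0, isCorrelationFunction_zero h⟩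
      · exact ⟨_, isCorrelationFunction_corrDensity hlaw hindep (N := n + 1 - k) (by omega)⟩
    exact ⟨ρ, hρ, fun ρ' hρ' => hρ'.unique hρ⟩
  · intro k ρ hρ y hy
    -- For smaller `n` the truncated subtraction may be meaningless, but only large `n` matter.
    have heq : ∀ n, k ≤ n → ρ n = corrDensity P G (n + 1 - k) := fun n hn =>
      (hρ n).unique (isCorrelationFunction_corrDensity hlaw hindep (by omega))
    have hshift : Tendsto (fun n => n + 1 - k) atTop atTop :=
      (tendsto_sub_atTop_nat k).comp (tendsto_add_atTop_nat 1)
    have hunif : TendstoUniformlyOn (fun N z => (corrDensity P G N z : ℂ)) (rhoInf k) atTop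
        {z : Fin k → ℂ | ∀ i, ‖z i‖ ≤ y} := by
      rw [← tendstoLocallyUniformlyOn_iff_tendstoUniformlyOn_of_compact
        (isCompact_setOf_norm_le k y), tendstoLocallyUniformlyOn_iff_forall_tendsto]
      intro z₀ hz₀
      have hz₁ : ∀ z ∈ {z : Fin k → ℂ | ∀ i, ‖z i‖ ≤ y}, ∀ i, ‖z i‖ < 1 := fun z hz i =>
        (hz i).trans_lt hy
      have h1 := (tendsto_corrDensity hlaw (hz₁ z₀ hz₀))
      have h2 : Tendsto (corrDensityLimit P G) (𝓝[{z : Fin k → ℂ | ∀ i, ‖z i‖ ≤ y}] z₀)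
          (𝓝 (corrDensityLimit P G z₀)) := by
        -- Joint convergence forces continuity of the limit: the densities lie in a closed
        -- neighbourhood for large `N` and `z` near `z₀`, and letting `N → ∞` at fixed `z` keeps the
        -- limit there.
        rw [(closed_nhds_basis (corrDensityLimit P G z₀)).tendsto_right_iff]
        rintro U ⟨hU, hUc⟩
        obtain ⟨p, hp, q, hq, hpq⟩ := eventually_prod_iff.1 (h1.eventually hU)
        filter_upwards [self_mem_nhdsWithin, nhdsWithin_le_nhds hq] with z hz hqz
        refine hUc.mem_of_tendsto (tendsto_corrDensity_apply hlaw (hz₁ z hz)) ?_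
        filter_upwards [hp] with N hN using hpq hN hqz
      have h3 : Tendsto (rhoInf k) (𝓝[{z : Fin k → ℂ | ∀ i, ‖z i‖ ≤ y}] z₀)
          (𝓝 (corrDensityLimit P G z₀ : ℂ)) := by
        refine ((Complex.continuous_ofReal.tendsto _).comp h2).congr' ?_
        filter_upwards [self_mem_nhdsWithin] with z hz
        exact corrDensityLimit_eq_rhoInf hlaw hindep (hz₁ z hz)
      have h4 : Tendsto (fun p : ℕ × (Fin k → ℂ) => (corrDensity P G p.1 p.2 : ℂ))
          (atTop ×ˢ 𝓝[{z : Fin k → ℂ | ∀ i, ‖z i‖ ≤ y}] z₀) (𝓝 (corrDensityLimit P G z₀ : ℂ)) :=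
        (Complex.continuous_ofReal.tendsto _).comp
          (h1.mono_left (prod_mono_right _ nhdsWithin_le_nhds))
      exact ((h3.comp tendsto_snd).prodMk_nhds h4).mono_right
        (nhds_le_uniformity _)
    refine TendstoUniformlyOn.congr (F := fun n z => (corrDensity P G (n + 1 - k) z : ℂ)) ?_ ?_
    · exact fun u hu => hshift.eventually (hunif u hu)
    · filter_upwards [eventually_ge_atTop k] with n hn z _
      rw [heq n hn]
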